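/- Let $G$ be a finite simple graph, $\{u,v\}$ an edge of $G$ with $\deg(u)\le\deg(v)$, and $\mathrm{dist}$ the shortest-path distance. For a node $x$ let $N(x)$ be its set of neighbours and $N[x]=N(x)\cup\{x\}$. **Curvature.** The Ollivier–Ricci curvature of the edge is $\mathfrak C_G(u,v)=1-\mathrm{EMD}$, where $\mathrm{EMD}$ is the minimum of $\sum_{x\in N[u]}\sum_{y\in N[v]}\mathrm{dist}(x,y)\,z_{x,y}$ over all $z\ge 0$ with $\sum_{y}z_{x,y}=\frac1{1+\deg(u)}$ for each $x\in N[u]$ and $\sum_{x}z_{x,y}=\frac1{1+\deg(v)}$ for each $y\in N[v]$. A number $c$ is an additive $r$-approximation of $\mathfrak C_G(u,v)$ if $\mathrm{EMD}\le 1-c\le \mathrm{EMD}+r$. **Graphs.** We use three complete bipartite graphs with integer edge weights: - $G_{u,v}$ has sides $N[u]$, $N[v]$ and weights $\mathrm{dist}(x,y)$. - $G'_{u,v}$ is obtained as follows: write $\deg(v)+1=a(\deg(u)+1)+b$ with $0\le b<\deg(u)+1$. Its left side consists of $a$ copies of every node of $N[u]$ and $b$ special nodes, its right side is $N[v]$.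 Copies inherit the weights of $G_{u,v}$, and all edges at special nodes have weight $3$. - $H$ has sides $L=N(u)\setminus(N(v)\cup\{v\})$, $R=N(v)\setminus(N(u)\cup\{u\})$ and weights $\mathrm{dist}(x,y)$. For such a graph $F$, $\deg_{F,j}(x)$ is the number of edges of weight $j$ at the node $x$. **Queries.** A weighted neighbour query $(x,s)$ on $F$ returns a uniformly random node among those nodes $z$ with $w(x,z)=s$ that have not been returned by earlier queries $(x,s)$, or a special symbol if there is none. A local algorithm may draw uniformly random nodes from either side of $F$, make weighted neighbour queries on $F$, recognize nodes seen before, and compute with the numbers $\deg(u)$, $\deg(v)$, $|N(u)\cap N(v)|$. Its program does not depend on $G$. Every draw, every query and every comparison is one instruction. **Claim.** Let $d\in\mathbb N$ and $\varepsilon,\delta>0$ be constants. Below, "admissible" means: $G$ is any finite graph, $\{u,v\}$ an edge with $\deg(u)\le\deg(v)$ and $\deg(u)\ge(1-\delta/3)\deg(v)$. 0. For each $j\in\{1,2\}$ there are a constant $D$ and a local algorithm using weighted neighbour queries for the weight $j$ only such that, for every admissible $(G,u,v)$ with $\max_x\deg_{G_{u,v},j}(x)\le d$: $\max_x\deg_{G'_{u,v},j}(x)\le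 D$, and, given any node $x$ of $G'_{u,v}$, the algorithm run on $G'_{u,v}$ always outputs $\deg_{G'_{u,v},j}(x)$ after at most $D$ instructions (a selective degree query is simulated by $O(1)$ weighted neighbour queries). 1. There are a constant $T$ and a local algorithm such that, for every admissible $(G,u,v)$ with $\max_x\deg_{H,1}(x)\le d$, the algorithm run on $H$ always stops after at most $T$ instructions (hence at most $T$ weighted neighbour queries), and with probability at least $2/3$ its output is an additive $(1+\varepsilon+\delta)$-approximation of $\mathfrak C_G(u,v)$. 2. There are a constant $T$ and a local algorithm such that, for every admissible $(G,u,v)$ with $\max_x\deg_{H,1}(x)\le d$ and $\max_x\deg_{H,2}(x)\le d$, the algorithm run on $H$ always stops after at most $T$ instructions, and with probability at least $2/3$ its output is an additive $(\tfrac12+\varepsilon+\delta)$-approximation of $\mathfrak C_G(u,v)$. The constants and programs depend only on $d,\varepsilon,\delta$ (and $j$). -/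

import Mathlib

universe w

noncomputable section

namespace RicciQuery

/-! ### Earth mover's distance and Ollivier-Ricci curvature -/

/-- Feasible solutions of the transportation linear program between `P` and `Q`. -/
def IsTransportPlan {A B : Type*} [Fintype A] [Fintype B]
    (P : A → ℝ) (Q : B → ℝ) (z : A → B → ℝ) : Prop :=
  (∀ x, ∑ y, z x y = P x) ∧ (∀ y, ∑ x, z x y = Q y) ∧ ∀ x y, 0 ≤ z x y

/-- Earth mover's distance over the complete bipartite graph with sides `A`, `B` and edge
weights `w`: the optimal value of the transportation linear program. -/
def emd {A B : Type*} [Fintype A] [Fintype B]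
    (w : A → B → ℝ) (P : A → ℝ) (Q : B → ℝ) : ℝ :=
  sInf {c : ℝ | ∃ z : A → B → ℝ, IsTransportPlan P Q z ∧ c = ∑ x, ∑ y, w x y * z x y}

section Graph

variable {V : Type*} [Fintype V] [DecidableEq V] (G : SimpleGraph V) [DecidableRel G.Adj]

/-- The closed neighbourhood `{x} ∪ Nbr(x)`, as a type. -/
abbrev ClosedNbr (x : V) : Type _ := {y : V // y ∈ insert x (G.neighborFinset x)}

/-- Edge weights of the complete bipartite graph `G_{u,v}`. -/
def guvWeight (u v : V) (x : ClosedNbr G u) (y : ClosedNbr G v) : ℕ := G.dist x.1 y.1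

/-- Ollivier-Ricci curvature of the edge `{u, v}`. -/
def curvature (u v : V) : ℝ :=
  1 - emd (fun (x : ClosedNbr G u) (y : ClosedNbr G v) => (guvWeight G u v x y : ℝ))
    (fun _ => 1 / (1 + (G.degree u : ℝ))) (fun _ => 1 / (1 + (G.degree v : ℝ)))

/-- `c` is an additive `r`-approximation of the curvature of `{u, v}`: the number `1 - c` is an
additive `r`-approximation `EMD ≤ 1 - c ≤ EMD + r` of the underlying minimization problem. -/
def IsAdditiveApprox (u v : V) (r c : ℝ) : Prop :=
  1 - curvature G u v ≤ 1 - c ∧ 1 - c ≤ (1 - curvature G u v) + r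

/-- The left side `Nbr(u) \ (Nbr(v) ∪ {v})` of the complete bipartite graph `H`. -/
abbrev HLeft (u v : V) : Type _ :=
  {x : V // x ∈ G.neighborFinset u \ (G.neighborFinset v ∪ {v})}

/-- The right side `Nbr(v) \ (Nbr(u) ∪ {u})` of the complete bipartite graph `H`. -/
abbrev HRight (u v : V) : Type _ :=
  {y : V // y ∈ G.neighborFinset v \ (G.neighborFinset u ∪ {u})}

/-- Edge weights of `H`. -/
def hWeight (u v : V) (x : HLeft G u v) (y : HRight G u v) : ℕ := G.dist x.1 y.1

/-- The left side of the balanced graph `G'_{u,v}`: writing `deg v + 1 = a (deg u + 1) + b` with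
`0 ≤ b < deg u + 1`, it has `a` copies of each node of the closed neighbourhood of `u`, and `b`
special nodes. The right side is the closed neighbourhood of `v`. -/
abbrev BalancedLeft (u v : V) : Type _ :=
  (ClosedNbr G u × Fin ((G.degree v + 1) / (G.degree u + 1))) ⊕
    Fin ((G.degree v + 1) % (G.degree u + 1))

/-- Edge weights of `G'_{u,v}`: copies inherit distances, special nodes have weight `3`. -/
def balancedWeight (u v : V) : BalancedLeft G u v → ClosedNbr G v → ℕ
  | Sum.inl (x, _), y => G.dist x.1 y.1
  | Sum.inr _, _ => 3

/-- The numbers known to a local algorithm from the two neighbour lists: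
`deg u`, `deg v`, and the number of common neighbours. -/
def knownNumbers (u v : V) : Fin 3 → ℚ :=
  ![(G.degree u : ℚ), (G.degree v : ℚ),
    ((G.neighborFinset u ∩ G.neighborFinset v).card : ℚ)]

end Graph

/-! ### Edge-weighted complete bipartite graphs

Such a graph is a function `w : A → B → ℕ`; its node set is `A ⊕ B`. -/

section Bipartite

variable {A B : Type*} [Fintype A] [Fintype B]

/-- The nodes joined to a given node by an edge of weight `s`. -/
def wNbrs (w : A → B → ℕ) : A ⊕ B → ℕ → Finset (A ⊕ B)
  | Sum.inl a, s => (Finset.univ.filter fun b => w a b = s).map Function.Embedding.inr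
  | Sum.inr b, s => (Finset.univ.filter fun a => w a b = s).map Function.Embedding.inl

/-- The number of edges of weight `s` incident on a node. -/
def wDeg (w : A → B → ℕ) (x : A ⊕ B) (s : ℕ) : ℕ := (wNbrs w x s).card

end Bipartite

/-! ### Local algorithms with weighted neighbour queries -/

/-- Arithmetic expressions in the numbers known to the algorithm. -/
inductive Expr : Type
  | const (q : ℚ)
  | var (i : Fin 3)
  | add (e f : Expr)
  | sub (e f : Expr)
  | mul (e f : Expr)
  | div (e f : Expr)

/-- Value of an expression. -/
def Expr.eval (env : Fin 3 → ℚ) : Expr → ℚ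
  | .const q => q
  | .var i => env i
  | .add e f => e.eval env + f.eval env
  | .sub e f => e.eval env - f.eval env
  | .mul e f => e.eval env * f.eval env
  | .div e f => e.eval env / f.eval env

/-- A local algorithm. It refers to nodes by their number in the order of discovery; whenever a
node is returned, the algorithm learns this number, so that it recognizes nodes seen before.
The program does not depend on the graph, and as long as it executes at most `T` instructions,
all the numbers it sees are less than `T` plus the number of initially known nodes, so that only a
finite decision tree is ever used.
* `output e` stops with the value of `e`;
* `ifLe e f p q` continues with `p` if the value of `e` is at most that of `f`, else with `q`;
* `sampleLeft k` and `sampleRight k` draw a uniformly random node of one side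
  (`none` if that side is empty);
* `query i s k` is the weighted neighbour query at node number `i` for the weight `s`. -/
inductive Prog : Type
  | output (e : Expr)
  | ifLe (e f : Expr) (p q : Prog)
  | sampleLeft (k : Option ℕ → Prog)
  | sampleRight (k : Option ℕ → Prog)
  | query (i s : ℕ) (k : Option ℕ → Prog)

/-- All queries of the program are for weight `s`. -/
def Prog.OnlyWeight (s : ℕ) : Prog → Prop
  | .output _ => True
  | .ifLe _ _ p q => p.OnlyWeight s ∧ q.OnlyWeight s
  | .sampleLeft k => ∀ o, (k o).OnlyWeight s
  | .sampleRight k => ∀ o, (k o).OnlyWeight s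
  | .query _ t k => t = s ∧ ∀ o, (k o).OnlyWeight s

/-- State of a run: the nodes discovered so far, in order of discovery, and for every node `x` and
weight `s` the set of nodes already returned by queries `(x, s)`. -/
structure State (X : Type*) where
  seen : List X
  answered : X → ℕ → Finset X

/-- Initial state, in which the nodes in a given list are known. -/
def State.init {X : Type*} (l : List X) : State X := ⟨l, fun _ _ => ∅⟩

section Run

variable {X : Type*} [DecidableEq X]

/-- Add a node to the list of discovered nodes. -/
def State.discover (σ : State X) : Option X → State X
  | none => σ
  | some z => ⟨if z ∈ σ.seen then σ.seen else σ.seen ++ [z], σ.answered⟩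

/-- Number of a node in the order of discovery (a new node gets the next free number). -/
def State.number (σ : State X) : Option X → Option ℕ
  | none => none
  | some z => some (σ.seen.idxOf z)

/-- Record that `z` was returned by a query for weight `s` at node number `i`. -/
def State.record (σ : State X) (i s : ℕ) : Option X → State X
  | none => σ
  | some z =>
    ⟨σ.seen, fun x t =>
      if σ.seen[i]? = some x ∧ t = s then insert z (σ.answered x t) else σ.answered x t⟩

/-- A uniformly random element of a finite set; the special symbol `none` if it is empty. -/
def draw (S : Finset X) : PMF (Option X) :=
  if h : S.Nonempty then (PMF.uniformOfFinset S h).map some else PMF.pure none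

end Run

section Semantics

variable {A B : Type*} [Fintype A] [Fintype B] [DecidableEq A] [DecidableEq B]

/-- Possible answers to the weighted neighbour query at node number `i` for the weight `s`: the
nodes `z` with `w(x, z) = s`, `x` being that node, not yet returned by queries `(x, s)`. -/
def answers (w : A → B → ℕ) (σ : State (A ⊕ B)) (i s : ℕ) : Finset (A ⊕ B) :=
  match σ.seen[i]? with
  | none => ∅
  | some x => wNbrs w x s \ σ.answered x s

/-- Count one more instruction. -/
def tick (o : ℚ × ℕ) : ℚ × ℕ := (o.1, o.2 + 1)

/-- Distribution of the pair (output, number of executed instructions) of a program on the graph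
`w`. Every query is an instruction, so the second entry bounds the number of queries. -/
def Prog.run (w : A → B → ℕ) (env : Fin 3 → ℚ) : Prog → State (A ⊕ B) → PMF (ℚ × ℕ)
  | .output e, _ => PMF.pure (e.eval env, 0)
  | .ifLe e f p q, σ =>
    (if e.eval env ≤ f.eval env then p.run w env σ else q.run w env σ).map tick
  | .sampleLeft k, σ =>
    (draw (Finset.univ.map Function.Embedding.inl)).bind fun o =>
      ((k (σ.number o)).run w env (σ.discover o)).map tick
  | .sampleRight k, σ =>
    (draw (Finset.univ.map Function.Embedding.inr)).bind fun o =>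
      ((k (σ.number o)).run w env (σ.discover o)).map tick
  | .query i s k, σ =>
    (draw (answers w σ i s)).bind fun o =>
      ((k (σ.number o)).run w env ((σ.record i s o).discover o)).map tick

end Semantics

/-- The local algorithm `p`, run on the graph `H` of the edge `{u, v}`, always executes at most
`T` instructions (in particular makes at most `T` queries), and with probability at least `2/3`
its output is an additive `r`-approximation of the curvature of `{u, v}`. -/
def Prog.Approximates {V : Type*} [Fintype V] [DecidableEq V] (p : Prog)
    (G : SimpleGraph V) [DecidableRel G.Adj] (u v : V) (T : ℕ) (r : ℝ) : Prop :=
  (∀ o ∈ (p.run (hWeight G u v) (knownNumbers G u v) (State.init [])).support, o.2 ≤ T) ∧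
  2 / 3 ≤ (p.run (hWeight G u v) (knownNumbers G u v) (State.init [])).toOuterMeasure
    {o | IsAdditiveApprox G u v r (o.1 : ℝ)}

end RicciQuery

end

/-!
The distances between the two sides of `H` are `1`, `2` or `3`, and truncating them at `k ≤ 3` costs
`3 - k`. For truncated distances, moving mass along an edge of weight `w` instead of at the full
price `k` gains `k - w`. Hence up to `(deg v - deg u) / (deg v + 1) ≤ δ / 3` of mass the earth
mover's distance is `k / (deg v + 1)` per node of the left side of `H`, minus the optimal gain of a
fractional matching in the graph of edges of weight `1, …, k - 1`: fractional matchings become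
transport plans, and feasible dual prices become Kantorovich potentials.

That graph has bounded degree, and constantly many rounds of the projected subgradient method on the
penalized dual program find prices and, by averaging the subgradients, a nearly optimal fractional
matching. One round looks only at neighbours, so the gain of the matching at a node is determined by
a ball of constant radius, which constantly many weighted neighbour queries explore completely.
The average gain is then estimated from a constant-size sample by Chebyshev's inequality.
-/

noncomputable section

namespace RicciQuery

/-! ### A local subgradient method for fractional matchings -/

section Subgradient

lemma sum_sum_edges_comm {X ι M : Type*} [Fintype X] [AddCommMonoid M] {N : X → Finset (X × ι)}
    (hN : ∀ u v c, (u, c) ∈ N v ↔ (v, c) ∈ N u) (F : X → X → ι → M) :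
    ∑ v, ∑ e ∈ N v, F v e.1 e.2 = ∑ v, ∑ e ∈ N v, F e.1 v e.2 := by
  simp only [Finset.sum_sigma']
  exact Finset.sum_nbij' (fun p => ⟨p.2.1, (p.1, p.2.2)⟩) (fun p => ⟨p.2.1, (p.1, p.2.2)⟩)
    (fun p => by simpa using (hN p.2.1 p.1 p.2.2).1) (fun p => by simpa using (hN _ _ _).1)
    (by simp) (by simp) (by simp)

variable {X 𝕜 : Type*} [Field 𝕜] [LinearOrder 𝕜]

/-- Indicator that the prices `y` violate the dual constraint `c ≤ y v + y u` of an edge of gain `c`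
between `v` and `u`. -/
def violated (y : X → 𝕜) (v u : X) (c : 𝕜) : 𝕜 := if y v + y u < c then 1 else 0

/-- Subgradient at `y` of the penalized dual objective
`∑ v, y v + ∑ max 0 (c - y v - y u)`, the second sum being over all edges. The edges at a node `v`
are listed in `N v`: a pair `(u, c)` is an edge to `u` of gain `c`. -/
def subgradient (N : X → Finset (X × 𝕜)) (y : X → 𝕜) (v : X) : 𝕜 :=
  1 - ∑ e ∈ N v, violated y v e.1 e.2

/-- Iterates of the projected subgradient method with step size `η`. -/
def price (N : X → Finset (X × 𝕜)) (η : 𝕜) : ℕ → X → 𝕜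
  | 0 => 0
  | t + 1 => fun v => max 0 (price N η t v - η * subgradient N (price N η t) v)

/-- Prices raised to a feasible solution of the dual linear program, at the cost of the penalty. -/
def raise (N : X → Finset (X × 𝕜)) (y : X → 𝕜) (v : X) : 𝕜 :=
  y v + (∑ e ∈ N v, max 0 (e.2 - y v - y e.1)) / 2

/-- The primal solution given by the first `T` subgradients: the fraction of the time during which
the edge was violated. It need not be a fractional matching. -/
def avgFlow (N : X → Finset (X × 𝕜)) (η : 𝕜) (T : ℕ) (v u : X) (c : 𝕜) : 𝕜 :=
  (∑ t ∈ Finset.range T, violated (price N η t) v u c) / T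

/-- Total average flow at a node. -/
def avgLoad (N : X → Finset (X × 𝕜)) (η : 𝕜) (T : ℕ) (v : X) : 𝕜 :=
  ∑ e ∈ N v, avgFlow N η T v e.1 e.2

/-- The average flow, scaled down at overloaded nodes to a fractional matching. -/
def scaledFlow (N : X → Finset (X × 𝕜)) (η : 𝕜) (T : ℕ) (v u : X) (c : 𝕜) : 𝕜 :=
  avgFlow N η T v u c / (max 1 (avgLoad N η T v) * max 1 (avgLoad N η T u))

/-- Gain of the scaled flow on the edges at a node. -/
def localGain (N : X → Finset (X × 𝕜)) (η : 𝕜) (T : ℕ) (v : X) : 𝕜 :=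
  ∑ e ∈ N v, e.2 * scaledFlow N η T v e.1 e.2

variable {N : X → Finset (X × 𝕜)} {η M Δ : 𝕜} {T : ℕ}

lemma violated_comm (y : X → 𝕜) (v u : X) (c : 𝕜) : violated y v u c = violated y u v c := by
  simp only [violated, add_comm]

lemma price_nonneg (t : ℕ) (v : X) : 0 ≤ price N η t v := by
  cases t with
  | zero => exact le_rfl
  | succ t => exact le_max_left _ _

lemma avgFlow_comm (v u : X) (c : 𝕜) : avgFlow N η T v u c = avgFlow N η T u v c := by
  simp only [avgFlow, violated_comm _ v u c]

lemma scaledFlow_comm (v u : X) (c : 𝕜) : scaledFlow N η T v u c = scaledFlow N η T u v c := by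
  simp only [scaledFlow, avgFlow_comm v u c, mul_comm]

variable [IsStrictOrderedRing 𝕜]

lemma violated_nonneg (y : X → 𝕜) (v u : X) (c : 𝕜) : 0 ≤ violated y v u c := by
  unfold violated; split_ifs <;> norm_num

lemma violated_le_one (y : X → 𝕜) (v u : X) (c : 𝕜) : violated y v u c ≤ 1 := by
  unfold violated; split_ifs <;> norm_num

lemma max_zero_eq_violated_mul (y : X → 𝕜) (v u : X) (c : 𝕜) :
    max 0 (c - y v - y u) = violated y v u c * (c - y v - y u) := by
  unfold violated
  split_ifs with h
  · rw [max_eq_right (by linarith), one_mul]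
  · rw [max_eq_left (by linarith), zero_mul]

lemma raise_nonneg {y : X → 𝕜} {v : X} (hy : 0 ≤ y v) : 0 ≤ raise N y v :=
  add_nonneg hy (div_nonneg (Finset.sum_nonneg fun _ _ => le_max_left _ _) zero_le_two)

lemma le_raise_add_raise (hN : ∀ u v c, (u, c) ∈ N v ↔ (v, c) ∈ N u) (y : X → 𝕜) {v u : X} {c : 𝕜}
    (he : (u, c) ∈ N v) : c ≤ raise N y v + raise N y u := by
  have penalty_le (v u : X) (he : (u, c) ∈ N v) :
      c - y v - y u ≤ ∑ e ∈ N v, max 0 (e.2 - y v - y e.1) :=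
    (le_max_right 0 _).trans <| Finset.single_le_sum
      (f := fun e : X × 𝕜 => max 0 (e.2 - y v - y e.1)) (fun _ _ => le_max_left _ _) he
  have hv := penalty_le v u he
  have hu := penalty_le u v ((hN u v c).1 he)
  unfold raise
  linarith

lemma avgFlow_nonneg (v u : X) (c : 𝕜) : 0 ≤ avgFlow N η T v u c :=
  div_nonneg (Finset.sum_nonneg fun _ _ => violated_nonneg _ _ _ _) (Nat.cast_nonneg _)

lemma scaledFlow_nonneg (v u : X) (c : 𝕜) : 0 ≤ scaledFlow N η T v u c :=
  div_nonneg (avgFlow_nonneg _ _ _) (by positivity)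

lemma sum_scaledFlow_le_one (v : X) : ∑ e ∈ N v, scaledFlow N η T v e.1 e.2 ≤ 1 :=
  calc ∑ e ∈ N v, scaledFlow N η T v e.1 e.2
      ≤ ∑ e ∈ N v, avgFlow N η T v e.1 e.2 / max 1 (avgLoad N η T v) :=
        Finset.sum_le_sum fun e _ => div_le_div_of_nonneg_left (avgFlow_nonneg _ _ _)
          (by positivity) (le_mul_of_one_le_right (by positivity) (le_max_left _ _))
    _ = avgLoad N η T v / max 1 (avgLoad N η T v) := by rw [avgLoad, Finset.sum_div]
    _ ≤ 1 := div_le_one_of_le₀ (le_max_right _ _) (by positivity)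

lemma localGain_nonneg {v : X} (hgain : ∀ e ∈ N v, 0 ≤ e.2) : 0 ≤ localGain N η T v :=
  Finset.sum_nonneg fun e he => mul_nonneg (hgain e he) (scaledFlow_nonneg _ _ _)

lemma localGain_le {v : X} (hM : 0 ≤ M) (hgain : ∀ e ∈ N v, e.2 ≤ M) : localGain N η T v ≤ M :=
  calc localGain N η T v ≤ ∑ e ∈ N v, M * scaledFlow N η T v e.1 e.2 :=
        Finset.sum_le_sum fun e he =>
          mul_le_mul_of_nonneg_right (hgain e he) (scaledFlow_nonneg _ _ _)
    _ = M * ∑ e ∈ N v, scaledFlow N η T v e.1 e.2 := by rw [Finset.mul_sum]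
    _ ≤ M := mul_le_of_le_one_right hM (sum_scaledFlow_le_one v)

lemma sum_subgradient (hT : T ≠ 0) (v : X) :
    ∑ t ∈ Finset.range T, subgradient N (price N η t) v = T * (1 - avgLoad N η T v) := by
  have hT' : (T : 𝕜) ≠ 0 := Nat.cast_ne_zero.2 hT
  have hload : T * avgLoad N η T v =
      ∑ t ∈ Finset.range T, ∑ e ∈ N v, violated (price N η t) v e.1 e.2 := by
    rw [avgLoad, Finset.sum_comm, Finset.mul_sum]
    exact Finset.sum_congr rfl fun e _ => mul_div_cancel₀ _ hT'
  simp only [subgradient, Finset.sum_sub_distrib, ← hload, Finset.sum_const, Finset.card_range,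
    nsmul_eq_mul, mul_one, mul_sub]

lemma sum_gain_mul_violated (hT : T ≠ 0) (v : X) :
    ∑ t ∈ Finset.range T, ∑ e ∈ N v, e.2 * violated (price N η t) v e.1 e.2 =
      T * ∑ e ∈ N v, e.2 * avgFlow N η T v e.1 e.2 := by
  have hT' : (T : 𝕜) ≠ 0 := Nat.cast_ne_zero.2 hT
  rw [Finset.sum_comm, Finset.mul_sum]
  refine Finset.sum_congr rfl fun e _ => ?_
  rw [← Finset.mul_sum, avgFlow]
  field_simp

lemma subgradient_sq_le (hΔ : 1 ≤ Δ) {v : X} (hdeg : (N v).card ≤ Δ) (y : X → 𝕜) :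
    subgradient N y v ^ 2 ≤ Δ ^ 2 := by
  have hpos : 0 ≤ ∑ e ∈ N v, violated y v e.1 e.2 :=
    Finset.sum_nonneg fun _ _ => violated_nonneg _ _ _ _
  have hle : ∑ e ∈ N v, violated y v e.1 e.2 ≤ Δ := by
    refine le_trans ?_ hdeg
    simpa only [nsmul_eq_mul, mul_one] using
      Finset.sum_le_card_nsmul (N v) _ 1 fun e _ => violated_le_one y v e.1 e.2
  unfold subgradient
  exact sq_le_sq' (by linarith) (by linarith)

lemma price_succ_sub_sq_le (hΔ : 1 ≤ Δ) {v : X} (hdeg : (N v).card ≤ Δ) {p : 𝕜} (hp : 0 ≤ p)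
    (t : ℕ) :
    (price N η (t + 1) v - p) ^ 2 ≤ (price N η t v - p) ^ 2
      - 2 * η * (subgradient N (price N η t) v * (price N η t v - p)) + η ^ 2 * Δ ^ 2 := by
  set y := price N η t v
  set g := subgradient N (price N η t) v
  have hproj : (max 0 (y - η * g) - p) ^ 2 ≤ (y - η * g - p) ^ 2 := by
    rcases le_total 0 (y - η * g) with h | h
    · rw [max_eq_right h]
    · rw [max_eq_left h]
      nlinarith
  have hg : η ^ 2 * g ^ 2 ≤ η ^ 2 * Δ ^ 2 :=
    mul_le_mul_of_nonneg_left (subgradient_sq_le hΔ hdeg _) (sq_nonneg η)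
  calc (price N η (t + 1) v - p) ^ 2 ≤ (y - η * g - p) ^ 2 := hproj
    _ = (y - p) ^ 2 - 2 * η * (g * (y - p)) + η ^ 2 * g ^ 2 := by ring
    _ ≤ _ := by linarith

lemma regret_le (hΔ : 1 ≤ Δ) {v : X} (hdeg : (N v).card ≤ Δ) {p : 𝕜} (hp : 0 ≤ p) (T : ℕ) :
    2 * η * ∑ t ∈ Finset.range T, subgradient N (price N η t) v * (price N η t v - p) ≤
      p ^ 2 + T * (η ^ 2 * Δ ^ 2) := by
  suffices h : 2 * η * ∑ t ∈ Finset.range T,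
      subgradient N (price N η t) v * (price N η t v - p) + (price N η T v - p) ^ 2 ≤
        p ^ 2 + T * (η ^ 2 * Δ ^ 2) by
    linarith [sq_nonneg (price N η T v - p)]
  induction T with
  | zero => simp [price]
  | succ T ih =>
    have := price_succ_sub_sq_le (η := η) hΔ hdeg hp T
    rw [Finset.sum_range_succ]
    push_cast
    linarith

variable [Fintype X]

lemma sum_raise (hN : ∀ u v c, (u, c) ∈ N v ↔ (v, c) ∈ N u) (y : X → 𝕜) :
    ∑ v, raise N y v = ∑ v, subgradient N y v * y v +
      (∑ v, ∑ e ∈ N v, e.2 * violated y v e.1 e.2) / 2 := by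
  have hswap : ∑ v, ∑ e ∈ N v, violated y v e.1 e.2 * y e.1 =
      ∑ v, (∑ e ∈ N v, violated y v e.1 e.2) * y v := by
    rw [sum_sum_edges_comm hN fun v u c => violated y v u c * y u]
    simp only [violated_comm y, Finset.sum_mul]
  have hpenalty (v : X) : ∑ e ∈ N v, max 0 (e.2 - y v - y e.1) =
      ∑ e ∈ N v, e.2 * violated y v e.1 e.2 - (∑ e ∈ N v, violated y v e.1 e.2) * y v
        - ∑ e ∈ N v, violated y v e.1 e.2 * y e.1 := by
    rw [Finset.sum_mul, ← Finset.sum_sub_distrib, ← Finset.sum_sub_distrib]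
    exact Finset.sum_congr rfl fun e _ => by rw [max_zero_eq_violated_mul]; ring
  simp only [raise, subgradient, hpenalty, sub_mul, one_mul, Finset.sum_add_distrib,
    Finset.sum_sub_distrib, ← Finset.sum_div, hswap]
  ring

lemma sum_sum_raise_le (hN : ∀ u v c, (u, c) ∈ N v ↔ (v, c) ∈ N u) (hΔ : 1 ≤ Δ)
    (hdeg : ∀ v, (N v).card ≤ Δ) (hη : 0 < η) (hT : T ≠ 0) {p : X → 𝕜} (hp : ∀ v, 0 ≤ p v) :
    ∑ t ∈ Finset.range T, ∑ v, raise N (price N η t) v ≤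
      T * ((∑ v, ∑ e ∈ N v, e.2 * avgFlow N η T v e.1 e.2) / 2 + ∑ v, (1 - avgLoad N η T v) * p v)
        + (∑ v, p v ^ 2 + Fintype.card X * (T * (η ^ 2 * Δ ^ 2))) / (2 * η) := by
  have hregret : 2 * η * ∑ t ∈ Finset.range T, ∑ v,
      subgradient N (price N η t) v * (price N η t v - p v) ≤
        ∑ v, p v ^ 2 + Fintype.card X * (T * (η ^ 2 * Δ ^ 2)) := by
    rw [Finset.sum_comm, Finset.mul_sum]
    refine (Finset.sum_le_sum fun v _ => regret_le hΔ (hdeg v) (hp v) T).trans_eq ?_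
    rw [Finset.sum_add_distrib, Finset.sum_const, Finset.card_univ, nsmul_eq_mul]
  have hcomparison : ∑ t ∈ Finset.range T, ∑ v, subgradient N (price N η t) v * p v =
      T * ∑ v, (1 - avgLoad N η T v) * p v := by
    rw [Finset.sum_comm, Finset.mul_sum]
    exact Finset.sum_congr rfl fun v _ => by rw [← Finset.sum_mul, sum_subgradient hT, mul_assoc]
  have hgain : ∑ t ∈ Finset.range T, (∑ v, ∑ e ∈ N v, e.2 * violated (price N η t) v e.1 e.2) / 2 =
      T * ((∑ v, ∑ e ∈ N v, e.2 * avgFlow N η T v e.1 e.2) / 2) := by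
    rw [← Finset.sum_div, Finset.sum_comm, Finset.sum_congr rfl fun v _ =>
      sum_gain_mul_violated hT v, ← Finset.mul_sum, mul_div_assoc]
  rw [mul_comm, ← le_div_iff₀ (by positivity)] at hregret
  simp only [sum_raise hN, Finset.sum_add_distrib, hgain]
  simp only [mul_sub, Finset.sum_sub_distrib, hcomparison] at hregret
  rw [mul_add]
  linarith

lemma sum_avgFlow_sub_scaledFlow_le (hN : ∀ u v c, (u, c) ∈ N v ↔ (v, c) ∈ N u) :
    ∑ v, ∑ e ∈ N v, (avgFlow N η T v e.1 e.2 - scaledFlow N η T v e.1 e.2) ≤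
      2 * ∑ v, (max 1 (avgLoad N η T v) - 1) := by
  set a : X → 𝕜 := fun v => max 1 (avgLoad N η T v)
  have ha (v : X) : 0 ≤ 1 - (a v)⁻¹ := sub_nonneg.2 (inv_le_one_of_one_le₀ (le_max_left _ _))
  have hfirst (v : X) : ∑ e ∈ N v, avgFlow N η T v e.1 e.2 * (1 - (a v)⁻¹) = a v - 1 := by
    rw [← Finset.sum_mul]
    change avgLoad N η T v * (1 - (a v)⁻¹) = a v - 1
    rcases le_total (avgLoad N η T v) 1 with h | h
    · simp [a, max_eq_left h]
    · rw [show a v = avgLoad N η T v from max_eq_right h, mul_sub, mul_one,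
        mul_inv_cancel₀ (by linarith)]
  have hsecond : ∑ v, ∑ e ∈ N v, avgFlow N η T v e.1 e.2 * (1 - (a e.1)⁻¹) = ∑ v, (a v - 1) := by
    rw [sum_sum_edges_comm hN fun v u c => avgFlow N η T v u c * (1 - (a u)⁻¹)]
    simp only [avgFlow_comm _ _, ← hfirst]
  calc ∑ v, ∑ e ∈ N v, (avgFlow N η T v e.1 e.2 - scaledFlow N η T v e.1 e.2)
      ≤ ∑ v, ∑ e ∈ N v, (avgFlow N η T v e.1 e.2 * (1 - (a v)⁻¹)
          + avgFlow N η T v e.1 e.2 * (1 - (a e.1)⁻¹)) := by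
        refine Finset.sum_le_sum fun v _ => Finset.sum_le_sum fun e _ => ?_
        rw [scaledFlow, div_eq_mul_inv, mul_inv]
        nlinarith [mul_nonneg (avgFlow_nonneg (N := N) (η := η) (T := T) v e.1 e.2)
          (mul_nonneg (ha v) (ha e.1))]
    _ = 2 * ∑ v, (a v - 1) := by
        simp only [Finset.sum_add_distrib, hfirst, hsecond, two_mul]

lemma sum_gain_avgFlow_le (hN : ∀ u v c, (u, c) ∈ N v ↔ (v, c) ∈ N u)
    (hM : 0 ≤ M) (hgain : ∀ v, ∀ e ∈ N v, e.2 ≤ M) :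
    ∑ v, ∑ e ∈ N v, e.2 * avgFlow N η T v e.1 e.2 ≤
      ∑ v, localGain N η T v + 2 * (M * ∑ v, (max 1 (avgLoad N η T v) - 1)) := by
  have hscaled (v u : X) (c : 𝕜) : scaledFlow N η T v u c ≤ avgFlow N η T v u c :=
    div_le_self (avgFlow_nonneg _ _ _) (one_le_mul_of_one_le_of_one_le (le_max_left _ _)
      (le_max_left _ _))
  calc ∑ v, ∑ e ∈ N v, e.2 * avgFlow N η T v e.1 e.2
      ≤ ∑ v, ∑ e ∈ N v, (e.2 * scaledFlow N η T v e.1 e.2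
          + M * (avgFlow N η T v e.1 e.2 - scaledFlow N η T v e.1 e.2)) := by
        refine Finset.sum_le_sum fun v _ => Finset.sum_le_sum fun e he => ?_
        linarith [mul_le_mul_of_nonneg_right (hgain v e he) (sub_nonneg.2 (hscaled v e.1 e.2))]
    _ = ∑ v, localGain N η T v
          + M * ∑ v, ∑ e ∈ N v, (avgFlow N η T v e.1 e.2 - scaledFlow N η T v e.1 e.2) := by
        simp only [Finset.sum_add_distrib, Finset.mul_sum, localGain]
    _ ≤ _ := by
        linarith [mul_le_mul_of_nonneg_left (sum_avgFlow_sub_scaledFlow_le (η := η) (T := T) hN) hM]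

theorem exists_dual_le_sum_localGain (hN : ∀ u v c, (u, c) ∈ N v ↔ (v, c) ∈ N u)
    (hM : 0 ≤ M) (hgain : ∀ v, ∀ e ∈ N v, e.2 ≤ M) (hΔ : 1 ≤ Δ) (hdeg : ∀ v, (N v).card ≤ Δ)
    (hη : 0 < η) (hT : T ≠ 0) :
    ∃ y : X → 𝕜, (∀ v, 0 ≤ y v) ∧ (∀ v, ∀ e ∈ N v, e.2 ≤ y v + y e.1) ∧
      ∑ v, y v ≤ (∑ v, localGain N η T v) / 2 +
        Fintype.card X * (M ^ 2 / (2 * η * T) + η * Δ ^ 2 / 2) := by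
  have _ : (0 : 𝕜) < T := Nat.cast_pos.2 (Nat.pos_of_ne_zero hT)
  -- Comparing with the prices `M` at the overloaded nodes pays for the loss of the scaling.
  set p : X → 𝕜 := fun v => if 1 < avgLoad N η T v then M else 0
  have hp (v : X) : 0 ≤ p v := by simp only [p]; split_ifs <;> simp [hM]
  have hp_sq : ∑ v, p v ^ 2 ≤ Fintype.card X * M ^ 2 := by
    simpa using Finset.sum_le_card_nsmul Finset.univ (fun v => p v ^ 2) (M ^ 2) fun v _ => by
      simp only [p]; split_ifs <;> simp [sq_nonneg]
  have hcomparison : ∑ v, (1 - avgLoad N η T v) * p v =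
      - (M * ∑ v, (max 1 (avgLoad N η T v) - 1)) := by
    rw [Finset.mul_sum, ← Finset.sum_neg_distrib]
    refine Finset.sum_congr rfl fun v _ => ?_
    simp only [p]
    split_ifs with h
    · rw [max_eq_right h.le]; ring
    · rw [max_eq_left (not_lt.1 h)]; ring
  have hsum := sum_sum_raise_le hN hΔ hdeg hη hT hp
  have hscale := sum_gain_avgFlow_le (η := η) (T := T) hN hM hgain
  obtain ⟨t, -, ht⟩ := Finset.exists_le_of_sum_le (s := Finset.range T) (g := fun _ =>
      (∑ v, localGain N η T v) / 2 + Fintype.card X * (M ^ 2 / (2 * η * T) + η * Δ ^ 2 / 2))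
    (Finset.nonempty_range_iff.2 hT) <| hsum.trans <| by
      rw [Finset.sum_const, Finset.card_range, nsmul_eq_mul, hcomparison]
      calc _ ≤ T * ((∑ v, localGain N η T v) / 2)
            + (Fintype.card X * M ^ 2 + Fintype.card X * (T * (η ^ 2 * Δ ^ 2))) / (2 * η) := by
            gcongr; linarith
        _ = _ := by field_simp
  exact ⟨raise N (price N η t), fun v => raise_nonneg (price_nonneg t v),
    fun v e he => le_raise_add_raise hN _ he, ht⟩

end Subgradient

/-! ### Locality -/

section Locality

variable {X Y 𝕜 : Type*} {N : X → Finset (X × 𝕜)} {N' : Y → Finset (Y × 𝕜)} {f : X → Y}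

/-- The map `f` between two graphs is an isomorphism at every node at distance less than `r`
from `x`. -/
def FaithfulBall (N : X → Finset (X × 𝕜)) (N' : Y → Finset (Y × 𝕜)) (f : X → Y) : ℕ → X → Prop
  | 0, _ => True
  | r + 1, x => Set.BijOn (Prod.map f (id : 𝕜 → 𝕜)) ↑(N x) ↑(N' (f x)) ∧
    ∀ e ∈ N x, FaithfulBall N N' f r e.1

lemma FaithfulBall.of_succ {r : ℕ} {x : X} (h : FaithfulBall N N' f (r + 1) x) :
    FaithfulBall N N' f r x := by
  induction r generalizing x with
  | zero => trivial
  | succ r ih => exact ⟨h.1, fun e he => ih (h.2 e he)⟩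

lemma FaithfulBall.anti {r s : ℕ} {x : X} (h : FaithfulBall N N' f s x) (hrs : r ≤ s) :
    FaithfulBall N N' f r x := by
  induction hrs with
  | refl => exact h
  | step _ ih => exact ih h.of_succ

lemma FaithfulBall.sum_edges_eq {M : Type*} [AddCommMonoid M] {r : ℕ} {x : X}
    (h : FaithfulBall N N' f (r + 1) x) {F : Y → 𝕜 → M} {G : X → 𝕜 → M}
    (hFG : ∀ u c, FaithfulBall N N' f r u → F (f u) c = G u c) :
    ∑ e ∈ N' (f x), F e.1 e.2 = ∑ e ∈ N x, G e.1 e.2 :=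
  (Finset.sum_nbij (Prod.map f id) h.1.mapsTo h.1.injOn h.1.surjOn fun e he =>
    (hFG e.1 e.2 (h.2 e he)).symm).symm

variable [Field 𝕜] [LinearOrder 𝕜] {η : 𝕜} {T : ℕ}

lemma FaithfulBall.price_eq {t : ℕ} {x : X} (h : FaithfulBall N N' f t x) :
    price N' η t (f x) = price N η t x := by
  induction t generalizing x with
  | zero => rfl
  | succ t ih =>
    simp only [price, subgradient, ih h.of_succ]
    rw [h.sum_edges_eq (G := violated (price N η t) x) fun u c hu => by
      simp only [violated, ih h.of_succ, ih hu]]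

lemma FaithfulBall.avgFlow_eq {x u : X} (hx : FaithfulBall N N' f T x)
    (hu : FaithfulBall N N' f T u) (c : 𝕜) :
    avgFlow N' η T (f x) (f u) c = avgFlow N η T x u c := by
  unfold avgFlow
  congr 1
  refine Finset.sum_congr rfl fun t ht => ?_
  have ht' := (Finset.mem_range.1 ht).le
  simp only [violated, (hx.anti ht').price_eq, (hu.anti ht').price_eq]

lemma FaithfulBall.avgLoad_eq {x : X} (h : FaithfulBall N N' f (T + 1) x) :
    avgLoad N' η T (f x) = avgLoad N η T x :=
  h.sum_edges_eq fun _ c hu => h.of_succ.avgFlow_eq hu c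

theorem FaithfulBall.localGain_eq {x : X} (h : FaithfulBall N N' f (T + 2) x) :
    localGain N' η T (f x) = localGain N η T x :=
  h.sum_edges_eq (F := fun u c => c * scaledFlow N' η T (f x) u c)
      (G := fun u c => c * scaledFlow N η T x u c) fun u c hu => by
    rw [scaledFlow, scaledFlow, h.of_succ.of_succ.avgFlow_eq hu.of_succ, h.of_succ.avgLoad_eq,
      hu.avgLoad_eq]

end Locality

/-! ### Bounds on the earth mover's distance -/

section Transport

variable {A B : Type*} [Fintype A] [Fintype B] {w : A → B → ℝ} {P : A → ℝ} {Q : B → ℝ}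

lemma exists_transportPlan_ge (hPQ : ∑ x, P x = ∑ y, Q y) {z : A → B → ℝ}
    (hz : ∀ x y, 0 ≤ z x y) (hP : ∀ x, ∑ y, z x y ≤ P x) (hQ : ∀ y, ∑ x, z x y ≤ Q y) :
    ∃ z', IsTransportPlan P Q z' ∧ ∀ x y, z x y ≤ z' x y := by
  -- Couple the missing masses `a` and `b` independently; their common total is `ρ`.
  set a : A → ℝ := fun x => P x - ∑ y, z x y
  set b : B → ℝ := fun y => Q y - ∑ x, z x y
  have ha (x : A) : 0 ≤ a x := sub_nonneg.2 (hP x)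
  have hb (y : B) : 0 ≤ b y := sub_nonneg.2 (hQ y)
  set ρ := ∑ x, a x
  have hρ : ρ = ∑ y, b y := by
    simp only [ρ, a, b, Finset.sum_sub_distrib, hPQ]
    rw [Finset.sum_comm]
  have hcoupling (x : A) (y : B) : 0 ≤ a x * b y / ρ :=
    div_nonneg (mul_nonneg (ha x) (hb y)) (Finset.sum_nonneg fun x _ => ha x)
  have ha_of_zero (x : A) (h : ρ = 0) : a x = 0 :=
    (Finset.sum_eq_zero_iff_of_nonneg fun x _ => ha x).1 h x (Finset.mem_univ x)
  have hb_of_zero (y : B) (h : ρ = 0) : b y = 0 :=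
    (Finset.sum_eq_zero_iff_of_nonneg fun y _ => hb y).1 (hρ ▸ h) y (Finset.mem_univ y)
  refine ⟨fun x y => z x y + a x * b y / ρ,
    ⟨fun x => ?_, fun y => ?_, fun x y => add_nonneg (hz x y) (hcoupling x y)⟩,
    fun x y => le_add_of_nonneg_right (hcoupling x y)⟩
  · rw [Finset.sum_add_distrib, ← Finset.sum_div, ← Finset.mul_sum, ← hρ,
      mul_div_cancel_of_imp (ha_of_zero x), add_sub_cancel]
  · rw [Finset.sum_add_distrib, ← Finset.sum_div, ← Finset.sum_mul, mul_comm,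
      mul_div_cancel_of_imp (hb_of_zero y), add_sub_cancel]

lemma emd_le_of_partial (hPQ : ∑ x, P x = ∑ y, Q y) (hw : ∀ x y, 0 ≤ w x y) {K : ℝ}
    (hK : ∀ x y, w x y ≤ K) {z : A → B → ℝ} (hz : ∀ x y, 0 ≤ z x y)
    (hP : ∀ x, ∑ y, z x y ≤ P x) (hQ : ∀ y, ∑ x, z x y ≤ Q y) :
    emd w P Q ≤ K * ∑ x, P x - ∑ x, ∑ y, (K - w x y) * z x y := by
  obtain ⟨z', hz', hle⟩ := exists_transportPlan_ge hPQ hz hP hQ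
  have hemd : emd w P Q ≤ ∑ x, ∑ y, w x y * z' x y := by
    refine csInf_le ⟨0, ?_⟩ ⟨z', hz', rfl⟩
    rintro c ⟨z, hz, rfl⟩
    exact Finset.sum_nonneg fun x _ => Finset.sum_nonneg fun y _ => mul_nonneg (hw x y) (hz.2.2 x y)
  have hgain : ∑ x, ∑ y, (K - w x y) * z x y ≤ ∑ x, ∑ y, (K - w x y) * z' x y := by
    gcongr with x _ y _
    · exact sub_nonneg.2 (hK x y)
    · exact hle x y
  have hcost : ∑ x, ∑ y, (K - w x y) * z' x y = K * ∑ x, P x - ∑ x, ∑ y, w x y * z' x y := by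
    simp only [sub_mul, Finset.sum_sub_distrib, ← Finset.mul_sum, hz'.1]
  linarith

lemma le_emd_of_potential (hPQ : ∑ x, P x = ∑ y, Q y) (hP : ∀ x, 0 ≤ P x) (hQ : ∀ y, 0 ≤ Q y)
    {φ : A → ℝ} {ψ : B → ℝ} (h : ∀ x y, ψ y - φ x ≤ w x y) :
    ∑ y, ψ y * Q y - ∑ x, φ x * P x ≤ emd w P Q := by
  obtain ⟨z₀, hz₀, -⟩ := exists_transportPlan_ge hPQ (z := fun _ _ => 0) (fun _ _ => le_rfl)
    (by simpa using hP) (by simpa using hQ)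
  refine le_csInf ⟨_, z₀, hz₀, rfl⟩ ?_
  rintro c ⟨z, hz, rfl⟩
  have hψ : ∑ x, ∑ y, ψ y * z x y = ∑ y, ψ y * Q y := by
    rw [Finset.sum_comm]
    simp only [← Finset.mul_sum, hz.2.1]
  have hφ : ∑ x, ∑ y, φ x * z x y = ∑ x, φ x * P x := by
    simp only [← Finset.mul_sum, hz.1]
  rw [← hψ, ← hφ, ← Finset.sum_sub_distrib]
  simp only [← Finset.sum_sub_distrib, ← sub_mul]
  gcongr with x _ y _
  · exact hz.2.2 x y
  · exact h x y

lemma emd_comp_equiv {A' B' : Type*} [Fintype A'] [Fintype B'] (e : A' ≃ A) (f : B' ≃ B) :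
    emd (fun x y => w (e x) (f y)) (P ∘ e) (Q ∘ f) = emd w P Q := by
  refine congrArg sInf (Set.ext fun c => ⟨?_, ?_⟩)
  · rintro ⟨z, ⟨hP, hQ, hz⟩, rfl⟩
    refine ⟨fun x y => z (e.symm x) (f.symm y), ⟨fun x => ?_, fun y => ?_, fun x y => hz _ _⟩, ?_⟩
    · rw [f.symm.sum_comp (z (e.symm x)), hP, Function.comp_apply, e.apply_symm_apply]
    · rw [e.symm.sum_comp (z · (f.symm y)), hQ, Function.comp_apply, f.apply_symm_apply]
    · simp [← e.sum_comp, ← f.sum_comp]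
  · rintro ⟨z, ⟨hP, hQ, hz⟩, rfl⟩
    refine ⟨fun x y => z (e x) (f y), ⟨fun x => ?_, fun y => ?_, fun x y => hz _ _⟩, ?_⟩
    · rw [f.sum_comp (z (e x)), hP, Function.comp_apply]
    · rw [e.sum_comp (z · (f y)), hQ, Function.comp_apply]
    · simp [← e.sum_comp, ← f.sum_comp]

variable {C L R : Type*} [Fintype C] [Fintype L] [Fintype R] {w : C ⊕ L → C ⊕ R → ℝ} {p q K : ℝ}

lemma emd_le_of_fractional_matching (hq : 0 ≤ q) (hqp : q ≤ p)
    (hmass : p * Fintype.card (C ⊕ L) = q * Fintype.card (C ⊕ R))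
    (hw : ∀ x y, 0 ≤ w x y) (hK : ∀ x y, w x y ≤ K) (hdiag : ∀ c, w (.inl c) (.inl c) = 0)
    {m : L → R → ℝ} (hm : ∀ l r, 0 ≤ m l r) (hrow : ∀ l, ∑ r, m l r ≤ 1)
    (hcol : ∀ r, ∑ l, m l r ≤ 1) :
    emd w (fun _ => p) (fun _ => q) ≤
      q * (K * Fintype.card R - ∑ l, ∑ r, (K - w (.inr l) (.inr r)) * m l r) := by
  classical
  set z : C ⊕ L → C ⊕ R → ℝ := fun x y => q * Matrix.fromBlocks 1 0 0 (Matrix.of m) x y with hz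
  have hz_nonneg (x y) : 0 ≤ z x y := mul_nonneg hq <| by
    rcases x with x | x <;> rcases y with y | y <;> simp [Matrix.one_apply, hm]
    split_ifs <;> norm_num
  have hz_row (x) : ∑ y, z x y ≤ p := by
    refine le_trans ?_ hqp
    rw [hz, ← Finset.mul_sum]
    refine mul_le_of_le_one_right hq ?_
    rcases x with x | x <;> simp [Matrix.one_apply, hrow]
  have hz_col (y) : ∑ x, z x y ≤ q := by
    rw [hz, ← Finset.mul_sum]
    refine mul_le_of_le_one_right hq ?_
    rcases y with y | y <;> simp [Matrix.one_apply, hcol]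
  have hgain : ∑ x, ∑ y, (K - w x y) * z x y =
      q * (K * Fintype.card C + ∑ l, ∑ r, (K - w (.inr l) (.inr r)) * m l r) := by
    simp only [hz, mul_left_comm _ q, ← Finset.mul_sum]
    simp [Matrix.one_apply, hdiag, mul_comm]
  have hplan := emd_le_of_partial (by simpa [mul_comm] using hmass) hw hK hz_nonneg hz_row hz_col
  rw [hgain, Finset.sum_const, Finset.card_univ, nsmul_eq_mul, mul_comm _ p, hmass,
    Fintype.card_sum, Nat.cast_add] at hplan
  linarith

lemma le_emd_of_block_potential (hq : 0 ≤ q) (hqp : q ≤ p)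
    (hmass : p * Fintype.card (C ⊕ L) = q * Fintype.card (C ⊕ R))
    {φC : C → ℝ} {φL : L → ℝ} {φR : R → ℝ} (hφC : ∀ c, φC c ≤ K) (hφL : ∀ l, φL l ≤ K)
    (hw : ∀ x y, Sum.elim φC φR y - Sum.elim φC φL x ≤ w x y) :
    q * (∑ r, φR r - ∑ l, φL l) - K * (p - q) * Fintype.card (C ⊕ L) ≤
      emd w (fun _ => p) (fun _ => q) := by
  have hdual := le_emd_of_potential (by simpa [mul_comm] using hmass) (fun _ => hq.trans hqp)
    (fun _ => hq) hw
  have hleft : ∑ x, Sum.elim φC φL x ≤ K * Fintype.card (C ⊕ L) := by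
    simpa only [Finset.card_univ, nsmul_eq_mul, mul_comm] using
      Finset.sum_le_card_nsmul Finset.univ (Sum.elim φC φL) K fun x _ => by
        rcases x with c | l
        exacts [hφC c, hφL l]
  have hscaled := mul_le_mul_of_nonneg_right hleft (sub_nonneg.2 hqp)
  simp only [Fintype.sum_sum_type, Sum.elim_inl, Sum.elim_inr, ← Finset.sum_mul]
    at hdual hscaled
  linarith

end Transport

/-! ### Curvature and the graph `H` -/

section Graph

lemma exists_sum_equiv_of_disjoint {α : Type*} [DecidableEq α] {s t r : Finset α}
    (hst : Disjoint s t) (hr : s ∪ t = r) :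
    ∃ e : s ⊕ t ≃ r, ∀ x, (e x : α) = x.elim Subtype.val Subtype.val := by
  subst hr
  exact ⟨Equiv.Finset.union s t hst, by rintro (x | x) <;> rfl⟩

lemma exists_lipschitz_extension {V ι : Type*} [Finite ι] (G : SimpleGraph V) (p : ι → V)
    (a : ι → ℝ) (K : ℝ) :
    ∃ φ : V → ℝ, (∀ x y, G.Reachable x y → φ y ≤ φ x + G.dist x y) ∧ (∀ x, φ x ≤ K) ∧
      (∀ i, φ (p i) ≤ a i) ∧
      ∀ x c, c ≤ K → (∀ i, c ≤ a i + G.dist (p i) x) → c ≤ φ x := by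
  -- McShane's formula, truncated at `K`.
  set f : V → Option ι → ℝ := fun x o => o.elim K fun i => a i + G.dist (p i) x
  have hle (x : V) (o : Option ι) : ⨅ o, f x o ≤ f x o := ciInf_le (Set.finite_range _).bddBelow o
  refine ⟨fun x => ⨅ o, f x o, fun x y hxy => ?_, fun x => hle x none, fun i => ?_,
    fun x c hK hc => le_ciInf fun o => ?_⟩
  · rw [ciInf_add (Set.finite_range _).bddBelow]
    refine le_ciInf fun o => (hle y o).trans ?_
    cases o with
    | none => exact le_add_of_nonneg_right (Nat.cast_nonneg _)
    | some i =>
      have : (G.dist (p i) y : ℝ) ≤ G.dist (p i) x + G.dist x y :=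
        mod_cast hxy.dist_triangle_right (p i)
      simp only [f, Option.elim]
      linarith
  · simpa [f] using hle (p i) (some i)
  · cases o with
    | none => exact hK
    | some i => exact hc i

variable {V : Type*} [Fintype V] [DecidableEq V] {G : SimpleGraph V} [DecidableRel G.Adj] {u v : V}

/-- The nodes in both closed neighbourhoods, where the mass need not move. -/
abbrev CommonNbr (G : SimpleGraph V) [DecidableRel G.Adj] (u v : V) : Type _ :=
  {x : V // x ∈ insert u (G.neighborFinset u) ∩ insert v (G.neighborFinset v)}

lemma neighborFinset_sdiff_eq (huv : G.Adj u v) :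
    G.neighborFinset u \ (G.neighborFinset v ∪ {v}) =
      insert u (G.neighborFinset u) \ insert v (G.neighborFinset v) := by
  rw [Finset.union_comm, ← Finset.insert_eq, Finset.insert_sdiff_of_mem]
  simpa using Or.inr huv.symm

lemma exists_equiv_closedNbr_left (huv : G.Adj u v) :
    ∃ e : CommonNbr G u v ⊕ HLeft G u v ≃ ClosedNbr G u,
      ∀ x, (e x).1 = x.elim Subtype.val Subtype.val := by
  refine exists_sum_equiv_of_disjoint ?_ ?_ <;> rw [neighborFinset_sdiff_eq huv]
  · exact Finset.disjoint_sdiff_inter _ _ |>.symm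
  · rw [Finset.union_comm, Finset.sdiff_union_inter]

lemma exists_equiv_closedNbr_right (huv : G.Adj u v) :
    ∃ e : CommonNbr G u v ⊕ HRight G u v ≃ ClosedNbr G v,
      ∀ x, (e x).1 = x.elim Subtype.val Subtype.val := by
  obtain ⟨e, he⟩ := exists_equiv_closedNbr_left huv.symm
  refine ⟨(Equiv.sumCongr (Equiv.subtypeEquivRight fun x => ?_) (Equiv.refl _)).trans e, ?_⟩
  · rw [Finset.inter_comm]
  · rintro (x | x) <;> exact he _

lemma card_closedNbr (x : V) : Fintype.card (ClosedNbr G x) = G.degree x + 1 := by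
  rw [Fintype.card_coe, Finset.card_insert_of_notMem (by simp),
    SimpleGraph.card_neighborFinset_eq_degree]

lemma card_common_sum_HLeft (huv : G.Adj u v) :
    Fintype.card (CommonNbr G u v ⊕ HLeft G u v) = G.degree u + 1 := by
  obtain ⟨e, -⟩ := exists_equiv_closedNbr_left huv
  rw [Fintype.card_congr e, card_closedNbr]

lemma card_common_sum_HRight (huv : G.Adj u v) :
    Fintype.card (CommonNbr G u v ⊕ HRight G u v) = G.degree v + 1 := by
  obtain ⟨e, -⟩ := exists_equiv_closedNbr_right huv
  rw [Fintype.card_congr e, card_closedNbr]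

lemma card_HLeft (huv : G.Adj u v) :
    Fintype.card (HLeft G u v) + ((G.neighborFinset u ∩ G.neighborFinset v).card + 1) =
      G.degree u := by
  have hcommon : G.neighborFinset u ∩ (G.neighborFinset v ∪ {v}) =
      insert v (G.neighborFinset u ∩ G.neighborFinset v) := by
    rw [Finset.union_comm, ← Finset.insert_eq, Finset.inter_insert_of_mem (by simpa using huv)]
  rw [Fintype.card_coe, ← Finset.card_insert_of_notMem (a := v) (by simp), ← hcommon,
    Finset.card_sdiff_add_card_inter, SimpleGraph.card_neighborFinset_eq_degree]

lemma card_HRight (huv : G.Adj u v) :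
    Fintype.card (HRight G u v) + ((G.neighborFinset u ∩ G.neighborFinset v).card + 1) =
      G.degree v := by
  rw [Finset.inter_comm]
  exact card_HLeft huv.symm

/-- Distances between the closed neighbourhoods, each split into the common nodes and a side
of `H`. -/
def blockDist (G : SimpleGraph V) [DecidableRel G.Adj] (u v : V)
    (x : CommonNbr G u v ⊕ HLeft G u v) (y : CommonNbr G u v ⊕ HRight G u v) : ℝ :=
  G.dist (x.elim Subtype.val Subtype.val) (y.elim Subtype.val Subtype.val)

lemma one_sub_curvature_eq_emd (huv : G.Adj u v) :
    1 - curvature G u v = emd (blockDist G u v) (fun _ => 1 / (1 + (G.degree u : ℝ)))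
      (fun _ => 1 / (1 + (G.degree v : ℝ))) := by
  obtain ⟨e, he⟩ := exists_equiv_closedNbr_left huv
  obtain ⟨f, hf⟩ := exists_equiv_closedNbr_right huv
  rw [curvature, sub_sub_cancel, ← emd_comp_equiv e f]
  simp only [guvWeight, he, hf]
  rfl

lemma uniform_mass_eq (huv : G.Adj u v) :
    1 / (1 + (G.degree u : ℝ)) * Fintype.card (CommonNbr G u v ⊕ HLeft G u v) =
      1 / (1 + (G.degree v : ℝ)) * Fintype.card (CommonNbr G u v ⊕ HRight G u v) := by
  rw [card_common_sum_HLeft huv, card_common_sum_HRight huv]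
  push_cast
  rw [add_comm (G.degree u : ℝ), add_comm (G.degree v : ℝ), one_div_mul_cancel (by positivity),
    one_div_mul_cancel (by positivity)]

lemma eq_or_adj_of_mem_closedNbr {x y : V} (hx : x ∈ insert y (G.neighborFinset y)) :
    y = x ∨ G.Adj y x := by
  rwa [Finset.mem_insert, SimpleGraph.mem_neighborFinset, eq_comm] at hx

lemma reachable_of_mem_closedNbr (huv : G.Adj u v) (x : ClosedNbr G u) (y : ClosedNbr G v) :
    G.Reachable x.1 y.1 := by
  have reachable_of {x y : V} (h : y = x ∨ G.Adj y x) : G.Reachable y x :=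
    h.elim (fun h => h ▸ .rfl) SimpleGraph.Adj.reachable
  exact ((reachable_of (eq_or_adj_of_mem_closedNbr x.2)).symm.trans huv.reachable).trans
    (reachable_of (eq_or_adj_of_mem_closedNbr y.2))

lemma dist_le_three_of_mem_closedNbr (huv : G.Adj u v) (x : ClosedNbr G u) (y : ClosedNbr G v) :
    G.dist x.1 y.1 ≤ 3 := by
  have dist_le_one {x y : V} (h : y = x ∨ G.Adj y x) : G.dist y x ≤ 1 := by
    rcases h with rfl | h
    · simp
    · exact (SimpleGraph.dist_eq_one_iff_adj.2 h).le
  have hux := dist_le_one (eq_or_adj_of_mem_closedNbr x.2)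
  have huv' := dist_le_one (.inr huv)
  have hvy := dist_le_one (eq_or_adj_of_mem_closedNbr y.2)
  have hxu := (reachable_of_mem_closedNbr huv x ⟨v, by simp⟩).trans huv.symm.reachable
  have hxuy := hxu.dist_triangle_left y.1
  have huvy := huv.reachable.dist_triangle_left y.1
  rw [G.dist_comm (u := x.1) (v := u)] at hxuy
  omega

theorem one_sub_curvature_le (huv : G.Adj u v) (hdeg : G.degree u ≤ G.degree v)
    {m : HLeft G u v → HRight G u v → ℝ} (hm : ∀ l r, 0 ≤ m l r) (hrow : ∀ l, ∑ r, m l r ≤ 1)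
    (hcol : ∀ r, ∑ l, m l r ≤ 1) :
    1 - curvature G u v ≤ (3 * Fintype.card (HRight G u v) -
      ∑ l, ∑ r, (3 - (hWeight G u v l r : ℝ)) * m l r) / (1 + G.degree v) := by
  obtain ⟨e, he⟩ := exists_equiv_closedNbr_left huv
  obtain ⟨f, hf⟩ := exists_equiv_closedNbr_right huv
  rw [one_sub_curvature_eq_emd huv]
  refine (emd_le_of_fractional_matching (w := blockDist G u v) (K := 3) (by positivity)
    (by gcongr) (uniform_mass_eq huv) (fun _ _ => Nat.cast_nonneg _) (fun x y => ?_)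
    (fun c => ?_) hm hrow hcol).trans_eq (one_div_mul_eq_div _ _)
  · rw [blockDist, ← he, ← hf]
    exact_mod_cast dist_le_three_of_mem_closedNbr huv (e x) (f y)
  · simp [blockDist]

theorem le_one_sub_curvature (huv : G.Adj u v) (hdeg : G.degree u ≤ G.degree v) {K : ℝ}
    {yl : HLeft G u v → ℝ} {yr : HRight G u v → ℝ} (hyr : ∀ r, 0 ≤ yr r)
    (h : ∀ l r, K - hWeight G u v l r ≤ yl l + yr r) :
    (K * Fintype.card (HRight G u v) - (∑ l, yl l + ∑ r, yr r) -
      K * ((G.degree v : ℝ) - G.degree u)) / (1 + G.degree v) ≤ 1 - curvature G u v := by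
  obtain ⟨e, he⟩ := exists_equiv_closedNbr_left huv
  obtain ⟨f, hf⟩ := exists_equiv_closedNbr_right huv
  obtain ⟨φ, hlip, hφK, hφl, hφr⟩ := exists_lipschitz_extension G
    (fun l : HLeft G u v => l.1) yl K
  have hpotential := le_emd_of_block_potential (w := blockDist G u v)
    (φC := fun c => φ c.1) (φL := fun l => φ l.1) (φR := fun r => φ r.1)
    (p := 1 / (1 + (G.degree u : ℝ))) (q := 1 / (1 + (G.degree v : ℝ)))
    (by positivity) (by gcongr) (uniform_mass_eq huv) (fun c => hφK c.1) (fun l => hφK l.1)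
    fun x y => by
      have hxy := hlip _ _ (reachable_of_mem_closedNbr huv (e x) (f y))
      rw [he, hf] at hxy
      rcases x with x | x <;> rcases y with y | y <;>
        simp only [blockDist, Sum.elim_inl, Sum.elim_inr] at hxy ⊢ <;> linarith
  have hleft : ∑ l : HLeft G u v, φ l.1 ≤ ∑ l, yl l := Finset.sum_le_sum fun l _ => hφl l
  have hright : K * Fintype.card (HRight G u v) - ∑ r, yr r ≤ ∑ r : HRight G u v, φ r.1 := by
    have : ∑ r : HRight G u v, (K - yr r) ≤ ∑ r : HRight G u v, φ r.1 :=
      Finset.sum_le_sum fun r _ => hφr _ _ (sub_le_self _ (hyr r)) fun l =>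
        sub_le_iff_le_add.2 <| by
          have := h l r
          rw [hWeight] at this
          linarith
    simpa [mul_comm] using this
  rw [card_common_sum_HLeft huv, ← one_sub_curvature_eq_emd huv] at hpotential
  refine le_trans (le_of_eq_of_le ?_ (sub_le_sub_right (mul_le_mul_of_nonneg_left
    (sub_le_sub hright hleft) (by positivity)) _)) hpotential
  push_cast
  field_simp
  ring

end Graph

/-! ### Exploring balls by weighted neighbour queries -/

section Query

lemma draw_support {X : Type*} (s : Finset X) (o : Option X) :
    o ∈ (draw s).support ↔ (o = none ∧ s = ∅) ∨ ∃ z ∈ s, o = some z := by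
  unfold draw
  split_ifs with h
  · simp only [PMF.support_map, PMF.support_uniformOfFinset, Set.mem_image, Finset.mem_coe,
      h.ne_empty, and_false, false_or, eq_comm]
  · rw [Finset.not_nonempty_iff_eq_empty] at h
    simp [h]

lemma getElem?_of_prefix {X : Type*} {l l' : List X} (h : l <+: l') {i : ℕ} {x : X}
    (hx : l[i]? = some x) : l'[i]? = some x := by
  obtain ⟨hi, rfl⟩ := List.getElem?_eq_some_iff.1 hx
  exact List.getElem?_eq_some_iff.2 ⟨hi.trans_le h.length_le, (h.getElem hi).symm⟩

variable {X : Type*} [DecidableEq X]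

/-- The number of a node in a list of nodes, with the equality test used by `State.number` (for a
sum type, `List.idxOf` would by default pick another one). -/
def index (l : List X) (z : X) : ℕ := l.idxOf z

lemma getElem?_index {l : List X} {z : X} (h : z ∈ l) : l[index l z]? = some z :=
  List.getElem?_idxOf h

lemma index_lt_length {l : List X} {z : X} (h : z ∈ l) : index l z < l.length :=
  List.idxOf_lt_length_of_mem h

lemma index_injOn (l : List X) : Set.InjOn (index l) {z | z ∈ l} := fun y hy z hz h =>
  Option.some.inj <| by rw [← getElem?_index hy, h, getElem?_index hz]

lemma index_cons_self (x : X) (l : List X) : index (x :: l) x = 0 :=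
  List.idxOf_cons_self

lemma index_append_of_mem {l : List X} {z : X} (hz : z ∈ l) (l' : List X) :
    index (l ++ l') z = index l z :=
  List.idxOf_append_of_mem hz

lemma index_eq_of_prefix {l l' : List X} (h : l <+: l') {z : X} (hz : z ∈ l) :
    index l' z = index l z := by
  obtain ⟨t, rfl⟩ := h
  exact index_append_of_mem hz t

lemma discover_of_mem {σ : State X} {z : X} (hz : z ∈ σ.seen) : σ.discover (some z) = σ := by
  simp [State.discover, hz]

lemma seen_discover_of_notMem {σ : State X} {z : X} (hz : z ∉ σ.seen) :
    (σ.discover (some z)).seen = σ.seen ++ [z] := by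
  simp [State.discover, hz]

lemma discover_prefix (σ : State X) (z : X) : σ.seen <+: (σ.discover (some z)).seen := by
  by_cases hz : z ∈ σ.seen
  · rw [discover_of_mem hz]
  · rw [seen_discover_of_notMem hz]
    exact List.prefix_append _ _

lemma mem_discover (σ : State X) (z : X) : z ∈ (σ.discover (some z)).seen := by
  by_cases hz : z ∈ σ.seen
  · rwa [discover_of_mem hz]
  · simp [seen_discover_of_notMem hz]

lemma length_discover_le (σ : State X) (z : X) :
    (σ.discover (some z)).seen.length ≤ σ.seen.length + 1 := by
  by_cases hz : z ∈ σ.seen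
  · simp [discover_of_mem hz]
  · simp [seen_discover_of_notMem hz]

lemma index_discover (σ : State X) (z : X) :
    index (σ.discover (some z)).seen z = index σ.seen z := by
  by_cases hz : z ∈ σ.seen
  · rw [discover_of_mem hz]
  · simp [index, seen_discover_of_notMem hz, List.idxOf_append_of_notMem hz,
      List.idxOf_eq_length hz]

lemma record_discover_comm (σ : State X) {i : ℕ} {x : X} (hx : σ.seen[i]? = some x) (s : ℕ)
    (z : X) : (σ.record i s (some z)).discover (some z) =
      (σ.discover (some z)).record i s (some z) := by
  have hx' := getElem?_of_prefix (discover_prefix σ z) hx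
  simp only [State.record, hx, hx']
  rfl

variable {A B : Type*} [Fintype A] [Fintype B] [DecidableEq A] [DecidableEq B]

/-- Every run of the program outputs `q` after at most `n` instructions. -/
def Outputs (w : A → B → ℕ) (env : Fin 3 → ℚ) (p : Prog) (σ : State (A ⊕ B)) (q : ℚ) (n : ℕ) :
    Prop :=
  ∀ o ∈ (p.run w env σ).support, o.1 = q ∧ o.2 ≤ n

variable {w : A → B → ℕ} {env : Fin 3 → ℚ} {σ : State (A ⊕ B)} {q : ℚ} {n : ℕ}

lemma outputs_output (e : Expr) : Outputs w env (.output e) σ (e.eval env) 0 := by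
  intro o ho
  rw [Prog.run, PMF.mem_support_pure_iff] at ho
  simp [ho]

lemma outputs_query {i s : ℕ} {k : Option ℕ → Prog}
    (hnone : answers w σ i s = ∅ → Outputs w env (k none) σ q n)
    (hsome : ∀ z ∈ answers w σ i s, Outputs w env (k (some (index σ.seen z)))
      ((σ.record i s (some z)).discover (some z)) q n) :
    Outputs w env (.query i s k) σ q (n + 1) := by
  intro o ho
  simp only [Prog.run, PMF.mem_support_bind_iff, PMF.mem_support_map_iff, draw_support] at ho
  obtain ⟨a, (⟨rfl, ha⟩ | ⟨z, hz, rfl⟩), o', ho', rfl⟩ := ho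
  · exact (hnone ha o' ho').imp_right Nat.succ_le_succ
  · exact (hsome z hz o' ho').imp_right Nat.succ_le_succ

/-- What a program remembers of the answers: `tbl i s` holds the numbers of the nodes returned by
queries for the weight `s` at node number `i`. -/
abbrev Table : Type := ℕ → ℕ → Finset ℕ

/-- Add the number `j` of a node returned by a query for the weight `s` at node number `i`. -/
def Table.record (tbl : Table) (i s j : ℕ) : Table := fun i' s' =>
  if i' = i ∧ s' = s then insert j (tbl i' s') else tbl i' s'

/-- A program that makes the queries of a list in turn and hands its table to `k`. -/
def queryAll : List (ℕ × ℕ) → Table → (Table → Prog) → Prog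
  | [], tbl, k => k tbl
  | (i, s) :: l, tbl, k => .query i s fun o => queryAll l (o.elim tbl (tbl.record i s)) k

lemma queryAll_onlyWeight {j : ℕ} {k : Table → Prog} (hk : ∀ tbl, (k tbl).OnlyWeight j)
    {l : List (ℕ × ℕ)} (hl : ∀ is ∈ l, is.2 = j) (tbl : Table) :
    (queryAll l tbl k).OnlyWeight j := by
  induction l generalizing tbl with
  | nil => exact hk tbl
  | cons is l ih =>
    exact ⟨hl is List.mem_cons_self, fun o => ih (fun is his => hl is (.tail _ his)) _⟩

/-- The table `tbl` describes the answers recorded in the state `σ`. -/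
structure Records (w : A → B → ℕ) (σ : State (A ⊕ B)) (tbl : Table) : Prop where
  nodup : σ.seen.Nodup
  answered_subset_wNbrs : ∀ x s, σ.answered x s ⊆ wNbrs w x s
  mem_seen : ∀ x s, ∀ z ∈ σ.answered x s, z ∈ σ.seen
  answered_of_notMem : ∀ x ∉ σ.seen, ∀ s, σ.answered x s = ∅
  table_eq : ∀ i s, tbl i s = σ.seen[i]?.elim ∅ fun x => (σ.answered x s).image (index σ.seen)

lemma records_init {l : List (A ⊕ B)} (hl : l.Nodup) :
    Records w (State.init l) fun _ _ => ∅ where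
  nodup := hl
  answered_subset_wNbrs _ _ := Finset.empty_subset _
  mem_seen _ _ _ hz := absurd hz (Finset.notMem_empty _)
  answered_of_notMem _ _ _ := rfl
  table_eq i s := by cases h : (State.init l).seen[i]? <;> simp [State.init]

variable {tbl : Table}

lemma Records.discover (h : Records w σ tbl) (z : A ⊕ B) :
    Records w (σ.discover (some z)) tbl := by
  by_cases hz : z ∈ σ.seen
  · rwa [discover_of_mem hz]
  have hseen := seen_discover_of_notMem hz
  refine ⟨?_, h.answered_subset_wNbrs, fun x s y hy =>
    (discover_prefix σ z).subset (h.mem_seen x s y hy), fun x hx s =>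
    h.answered_of_notMem x (fun hx' => hx ((discover_prefix σ z).subset hx')) s, fun i s => ?_⟩
  · rw [hseen]
    exact List.nodup_append_comm.1 (List.nodup_cons.2 ⟨hz, h.nodup⟩)
  · rw [h.table_eq, hseen]
    rcases lt_trichotomy i σ.seen.length with hi | rfl | hi
    · rw [List.getElem?_append_left hi, List.getElem?_eq_getElem hi]
      exact Finset.image_congr fun y hy =>
        (index_append_of_mem (h.mem_seen _ _ y hy) [z]).symm
    · simp [State.discover, h.answered_of_notMem z hz]
    · rw [List.getElem?_eq_none hi.le, List.getElem?_eq_none (by simpa using hi)]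
      rfl

lemma Records.record (h : Records w σ tbl) {i s : ℕ} {x z : A ⊕ B} (hx : σ.seen[i]? = some x)
    (hz : z ∈ σ.seen) (hxz : z ∈ wNbrs w x s) :
    Records w (σ.record i s (some z)) (tbl.record i s (index σ.seen z)) := by
  have hx_mem : x ∈ σ.seen := List.mem_of_getElem? hx
  refine ⟨h.nodup, fun y t => ?_, fun y t => ?_, fun y hy t => ?_, fun j t => ?_⟩
  · simp only [State.record, hx, Option.some.injEq]
    split_ifs with hyt
    · exact Finset.insert_subset (hyt.1 ▸ hyt.2 ▸ hxz) (h.answered_subset_wNbrs y t)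
    · exact h.answered_subset_wNbrs y t
  · simp only [State.record, hx, Option.some.injEq]
    split_ifs
    · simpa [hz] using h.mem_seen y t
    · exact h.mem_seen y t
  · have hxy : x ≠ y := fun hxy => hy (hxy ▸ hx_mem)
    simpa [State.record, hx, hxy] using h.answered_of_notMem y hy t
  · have hij {y} (hy : σ.seen[j]? = some y) : j = i ↔ x = y := by
      rw [← Option.some_inj (a := x), ← hx, ← hy]
      exact ⟨fun hji => by rw [hji], fun hij =>
        ((List.getElem?_inj (List.getElem?_eq_some_iff.1 hx).1 h.nodup).1 hij).symm⟩
    simp only [Table.record, State.record, h.table_eq]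
    cases hj : σ.seen[j]? with
    | none => simp [show j ≠ i by rintro rfl; simp [hx] at hj]
    | some y =>
      simp only [hij hj, hx, Option.some.injEq, Option.elim]
      split_ifs
      · rw [Finset.image_insert]
      · rfl

/-- What the queries of the list `l`, made from the state `σ`, guarantee about the state `σ'`
reached: few nodes are discovered, and each repetition of a query returns a new neighbour as long
as there is one. -/
structure AfterQueries (w : A → B → ℕ) (l : List (ℕ × ℕ)) (σ σ' : State (A ⊕ B)) : Prop where
  seen_prefix : σ.seen <+: σ'.seen
  length_le : σ'.seen.length ≤ σ.seen.length + l.length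
  min_le_card : ∀ i x s, σ.seen[i]? = some x →
    min (wDeg w x s) (l.count (i, s) + (σ.answered x s).card) ≤ (σ'.answered x s).card

variable {σ' : State (A ⊕ B)} {l : List (ℕ × ℕ)} {i s : ℕ}

lemma AfterQueries.cons_of_answers_eq_empty (h : AfterQueries w l σ σ')
    (hσ : answers w σ i s = ∅) : AfterQueries w ((i, s) :: l) σ σ' := by
  refine ⟨h.seen_prefix, h.length_le.trans (by simp), fun j x t hx => ?_⟩
  have hle := h.min_le_card j x t hx
  rcases eq_or_ne (i, s) (j, t) with hij | hij
  · obtain ⟨rfl, rfl⟩ := Prod.mk.inj hij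
    have hsub : wDeg w x s ≤ (σ.answered x s).card := by
      simp only [answers, hx, Finset.sdiff_eq_empty_iff_subset] at hσ
      exact Finset.card_le_card hσ
    omega
  · rwa [List.count_cons_of_ne hij]

lemma AfterQueries.cons_of_mem_answers {z : A ⊕ B} (hz : z ∈ answers w σ i s)
    (h : AfterQueries w l ((σ.record i s (some z)).discover (some z)) σ') :
    AfterQueries w ((i, s) :: l) σ σ' := by
  have hpre := discover_prefix (σ.record i s (some z)) z
  refine ⟨hpre.trans h.seen_prefix, h.length_le.trans ?_, fun j x t hx => ?_⟩
  · rw [List.length_cons, ← add_assoc, add_right_comm]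
    exact Nat.add_le_add_right (length_discover_le (σ.record i s (some z)) z) _
  refine le_trans ?_ (h.min_le_card j x t (getElem?_of_prefix hpre hx))
  simp only [State.discover, State.record]
  rcases eq_or_ne (i, s) (j, t) with hij | hij
  · obtain ⟨rfl, rfl⟩ := Prod.mk.inj hij
    simp only [answers, hx, Finset.mem_sdiff] at hz
    rw [if_pos ⟨hx, rfl⟩, Finset.card_insert_of_notMem hz.2, List.count_cons_self]
    omega
  · rw [List.count_cons_of_ne hij]
    gcongr
    split_ifs
    · exact Finset.subset_insert _ _
    · exact Finset.Subset.rfl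

lemma outputs_queryAll (h : Records w σ tbl) {k : Table → Prog}
    (hk : ∀ σ' tbl', Records w σ' tbl' → AfterQueries w l σ σ' → Outputs w env (k tbl') σ' q n) :
    Outputs w env (queryAll l tbl k) σ q (n + l.length) := by
  induction l generalizing σ tbl with
  | nil => exact hk σ tbl h ⟨List.prefix_rfl, le_rfl, by simp⟩
  | cons is l ih =>
    obtain ⟨i, s⟩ := is
    refine outputs_query (fun hσ => ih h fun σ' tbl' h' hl =>
      hk σ' tbl' h' (hl.cons_of_answers_eq_empty hσ)) fun z hz => ?_
    refine ih ?_ fun σ' tbl' h' hl => hk σ' tbl' h' (hl.cons_of_mem_answers hz)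
    cases hx : σ.seen[i]? with
    | none => simp [answers, hx] at hz
    | some x =>
      simp only [answers, hx, Finset.mem_sdiff] at hz
      rw [record_discover_comm σ hx, ← index_discover]
      exact (h.discover z).record (getElem?_of_prefix (discover_prefix σ z) hx)
        (mem_discover σ z) hz.1

lemma AfterQueries.answered_eq (h : AfterQueries w l σ σ') (hσ' : Records w σ' tbl) {x : A ⊕ B}
    (hx : σ.seen[i]? = some x) (hs : wDeg w x s ≤ l.count (i, s) + (σ.answered x s).card) :
    σ'.answered x s = wNbrs w x s :=
  Finset.eq_of_subset_of_card_le (hσ'.answered_subset_wNbrs x s)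
    ((min_eq_left hs).ge.trans (h.min_le_card i x s hx))

lemma Records.table_index (h : Records w σ tbl) {x : A ⊕ B} (hx : x ∈ σ.seen) (s : ℕ) :
    tbl (index σ.seen x) s = (σ.answered x s).image (index σ.seen) := by
  rw [h.table_eq, getElem?_index hx, Option.elim]

lemma Records.card_table_index (h : Records w σ tbl) {x : A ⊕ B} (hx : x ∈ σ.seen) (s : ℕ) :
    (tbl (index σ.seen x) s).card = (σ.answered x s).card := by
  rw [h.table_index hx, Finset.card_image_of_injOn ((index_injOn _).mono (h.mem_seen x s))]

theorem outputs_wDeg {j D : ℕ} (x : A ⊕ B) (hD : wDeg w x j ≤ D) :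
    Outputs w env (queryAll (List.replicate D (0, j)) (fun _ _ => ∅)
      fun tbl => .output (.const (tbl 0 j).card)) (State.init [x]) (wDeg w x j) D := by
  suffices h : Outputs w env _ _ (wDeg w x j) (0 + (List.replicate D (0, j)).length) by
    simpa using h
  refine outputs_queryAll (records_init (List.nodup_singleton x)) fun σ tbl hσ hl => ?_
  have hx : x ∈ σ.seen := hl.seen_prefix.subset (List.mem_singleton_self x)
  have hidx : index σ.seen x = 0 :=
    (index_eq_of_prefix hl.seen_prefix (List.mem_singleton_self x)).trans (index_cons_self x [])
  have hcard : (tbl 0 j).card = wDeg w x j := by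
    rw [← hidx, hσ.card_table_index hx,
      hl.answered_eq (i := 0) hσ rfl (by simp [State.init, hD]), wDeg]
  rw [← hcard]
  exact outputs_output _

end Query

section Explore

variable {X Y : Type*} [DecidableEq X] [DecidableEq Y] {k : ℕ}

/-- The edges at a node whose neighbours at distance `s` are `nbrs s`, where distances are
truncated at `k`: an edge of weight `s` gains `k - s`, and only edges with a positive gain count. -/
def gainEdges (k : ℕ) (nbrs : ℕ → Finset X) : Finset (X × ℚ) :=
  (Finset.Ico 1 k).biUnion fun s => (nbrs s).image fun z => (z, (k : ℚ) - s)

lemma mem_gainEdges {nbrs : ℕ → Finset X} {e : X × ℚ} :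
    e ∈ gainEdges k nbrs ↔ ∃ s ∈ Finset.Ico 1 k, e.1 ∈ nbrs s ∧ (k : ℚ) - s = e.2 := by
  obtain ⟨z, c⟩ := e
  simp only [gainEdges, Finset.mem_biUnion, Finset.mem_image, Prod.mk.injEq]
  grind

lemma gainEdges_image (f : X → Y) (nbrs : ℕ → Finset X) :
    gainEdges k (fun s => (nbrs s).image f) = (gainEdges k nbrs).image (Prod.map f id) := by
  simp only [gainEdges, Finset.biUnion_image, Finset.image_image]
  rfl

lemma gainEdges_congr {nbrs nbrs' : ℕ → Finset X} (h : ∀ s ∈ Finset.Ico 1 k, nbrs s = nbrs' s) :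
    gainEdges k nbrs = gainEdges k nbrs' :=
  Finset.biUnion_congr rfl fun s hs => by rw [h s hs]

lemma card_gainEdges_le {nbrs : ℕ → Finset X} {d : ℕ}
    (h : ∀ s ∈ Finset.Ico 1 k, (nbrs s).card ≤ d) : (gainEdges k nbrs).card ≤ (k - 1) * d :=
  (Finset.card_biUnion_le_card_mul _ _ d fun s hs => Finset.card_image_le.trans (h s hs)).trans_eq
    (by rw [Nat.card_Ico])

/-- One round of exploration: at each of the first `M` nodes, `d` repetitions of the query for
each weight below `k`. -/
def roundQueries (k d M : ℕ) : List (ℕ × ℕ) :=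
  (List.replicate d (Finset.range M ×ˢ Finset.Ico 1 k).toList).flatten

lemma count_roundQueries {d M i s : ℕ} (hi : i < M) (hs : s ∈ Finset.Ico 1 k) :
    (roundQueries k d M).count (i, s) = d := by
  have honce : (Finset.range M ×ˢ Finset.Ico 1 k).toList.count (i, s) = 1 :=
    List.count_eq_one_of_mem (Finset.nodup_toList _) <| Finset.mem_toList.2 <|
      Finset.mk_mem_product (Finset.mem_range.2 hi) hs
  rw [roundQueries, List.count_flatten, List.map_replicate, honce, List.sum_replicate, smul_eq_mul,
    mul_one]

/-- A program that explores the balls of radius `r` around the first `M` nodes by `r` rounds of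
queries, and hands its table to `c`. -/
def explore (k d : ℕ) : ℕ → ℕ → Table → (Table → Prog) → Prog
  | 0, _, tbl, c => c tbl
  | r + 1, M, tbl, c => queryAll (roundQueries k d M) tbl fun tbl' =>
      explore k d r (M + (roundQueries k d M).length) tbl' c

/-- The number of instructions of `explore`. -/
def exploreCost (k d : ℕ) : ℕ → ℕ → ℕ
  | 0, _ => 0
  | r + 1, M => exploreCost k d r (M + (roundQueries k d M).length) + (roundQueries k d M).length

variable {A B : Type*} [Fintype A] [Fintype B] [DecidableEq A] [DecidableEq B]

/-- The edges at the nodes of a weighted bipartite graph, with the gains of the distances truncated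
at `k`. -/
abbrev gainGraph (w : A → B → ℕ) (k : ℕ) (x : A ⊕ B) : Finset ((A ⊕ B) × ℚ) :=
  gainEdges k (wNbrs w x)

variable {w : A → B → ℕ} {env : Fin 3 → ℚ} {σ σ' : State (A ⊕ B)} {tbl : Table} {q : ℚ} {n d : ℕ}

lemma Records.bijOn_gainEdges (h : Records w σ tbl) {x : A ⊕ B} (hx : x ∈ σ.seen)
    (hfull : ∀ s ∈ Finset.Ico 1 k, σ.answered x s = wNbrs w x s) :
    Set.BijOn (Prod.map (index σ.seen) (id : ℚ → ℚ)) ↑(gainGraph w k x)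
      ↑(gainEdges k (tbl (index σ.seen x))) := by
  have himage : gainEdges k (tbl (index σ.seen x)) =
      (gainGraph w k x).image (Prod.map (index σ.seen) id) := by
    rw [← gainEdges_image]
    exact gainEdges_congr fun s hs => by rw [h.table_index hx, hfull s hs]
  rw [himage, Finset.coe_image]
  refine Set.InjOn.bijOn_image fun e he e' he' hee' => ?_
  have mem_seen {e} (he : e ∈ gainGraph w k x) : e.1 ∈ σ.seen := by
    obtain ⟨s, hs, hes, -⟩ := mem_gainEdges.1 he
    exact h.mem_seen x s _ (hfull s hs ▸ hes)
  obtain ⟨hfst, hsnd⟩ := Prod.mk.inj hee'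
  exact Prod.ext (index_injOn _ (mem_seen he) (mem_seen he') hfst) hsnd

lemma AfterQueries.answered_eq_of_answered_eq {l : List (ℕ × ℕ)} (h : AfterQueries w l σ σ')
    (hσ' : Records w σ' tbl) {x : A ⊕ B} (hx : x ∈ σ.seen) {s : ℕ}
    (hs : σ.answered x s = wNbrs w x s) : σ'.answered x s = wNbrs w x s :=
  h.answered_eq hσ' (getElem?_index hx) (by rw [hs]; exact Nat.le_add_left _ _)

lemma AfterQueries.answered_eq_of_round {M : ℕ} (h : AfterQueries w (roundQueries k d M) σ σ')
    (hσ' : Records w σ' tbl) (hM : σ.seen.length ≤ M) {x : A ⊕ B} (hx : x ∈ σ.seen) {s : ℕ}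
    (hs : s ∈ Finset.Ico 1 k) (hd : wDeg w x s ≤ d) : σ'.answered x s = wNbrs w x s := by
  refine h.answered_eq hσ' (getElem?_index hx) (hd.trans ?_)
  rw [count_roundQueries ((index_lt_length hx).trans_le hM) hs]
  exact Nat.le_add_right d _

/-- Exploration of the balls of radius `r` around the nodes of `σ` has led to `σ'`, with table
`tbl`, and no complete answer has been lost. -/
structure AfterExploring (w : A → B → ℕ) (k r : ℕ) (σ σ' : State (A ⊕ B)) (tbl : Table) :
    Prop where
  records : Records w σ' tbl
  seen_prefix : σ.seen <+: σ'.seen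
  answered_eq : ∀ x ∈ σ.seen, ∀ s, σ.answered x s = wNbrs w x s → σ'.answered x s = wNbrs w x s
  faithfulBall : ∀ x ∈ σ.seen, FaithfulBall (gainGraph w k) (fun i => gainEdges k (tbl i))
    (index σ'.seen) r x

lemma AfterExploring.of_round {σ₁ : State (A ⊕ B)} {tbl₁ : Table} {r M : ℕ}
    (hd : ∀ x, ∀ s ∈ Finset.Ico 1 k, wDeg w x s ≤ d) (hM : σ.seen.length ≤ M)
    (h₁ : Records w σ₁ tbl₁) (hround : AfterQueries w (roundQueries k d M) σ σ₁)
    (h : AfterExploring w k r σ₁ σ' tbl) : AfterExploring w k (r + 1) σ σ' tbl := by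
  have hseen {x} (hx : x ∈ σ.seen) : x ∈ σ₁.seen := hround.seen_prefix.subset hx
  have hfull {x} (hx : x ∈ σ.seen) {s} (hs : s ∈ Finset.Ico 1 k) : σ₁.answered x s = wNbrs w x s :=
    hround.answered_eq_of_round h₁ hM hx hs (hd x s hs)
  refine ⟨h.records, hround.seen_prefix.trans h.seen_prefix, fun x hx s hs => ?_,
    fun x hx => ⟨?_, fun e he => h.faithfulBall _ ?_⟩⟩
  · exact h.answered_eq x (hseen hx) s (hround.answered_eq_of_answered_eq h₁ hx hs)
  · exact h.records.bijOn_gainEdges (h.seen_prefix.subset (hseen hx)) fun s hs =>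
      h.answered_eq x (hseen hx) s (hfull hx hs)
  · obtain ⟨s, hs, hes, -⟩ := mem_gainEdges.1 he
    exact h₁.mem_seen x s _ (hfull hx hs ▸ hes)

theorem outputs_explore (hd : ∀ x, ∀ s ∈ Finset.Ico 1 k, wDeg w x s ≤ d) {r M : ℕ}
    (h : Records w σ tbl) (hM : σ.seen.length ≤ M) {c : Table → Prog}
    (hc : ∀ σ' tbl', AfterExploring w k r σ σ' tbl' → Outputs w env (c tbl') σ' q n) :
    Outputs w env (explore k d r M tbl c) σ q (n + exploreCost k d r M) := by
  induction r generalizing σ tbl M with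
  | zero => exact hc σ tbl ⟨h, List.prefix_rfl, fun _ _ _ => id, fun _ _ => trivial⟩
  | succ r ih =>
    rw [exploreCost, ← add_assoc]
    exact outputs_queryAll h fun σ₁ tbl₁ h₁ hround =>
      ih h₁ (hround.length_le.trans (Nat.add_le_add_right hM _)) fun σ' tbl' hrest =>
        hc σ' tbl' (.of_round hd hM h₁ hround hrest)

end Explore

/-! ### Uniform sampling -/

section Expectation

open scoped BigOperators

lemma sum_map_sub_const {A : Type*} (f : A → ℝ) (c : ℝ) (l : List A) :
    (l.map fun a => f a - c).sum = (l.map f).sum - l.length * c := by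
  induction l with
  | nil => simp
  | cons a l ih =>
    simp only [List.map_cons, List.sum_cons, List.length_cons, ih]
    push_cast
    ring

variable {A : Type*} [Fintype A] {m : ℕ}

/-- Expectation of a function of `m` independent uniformly random elements of `A`. -/
def expectList : ℕ → (List A → ℝ) → ℝ
  | 0, F => F []
  | m + 1, F => 𝔼 a, expectList m fun l => F (a :: l)

lemma expectList_mono {F F' : List A → ℝ} (h : ∀ l, l.length = m → F l ≤ F' l) :
    expectList m F ≤ expectList m F' := by
  induction m generalizing F F' with
  | zero => exact h [] rfl
  | succ m ih =>
    exact Finset.expect_le_expect fun a _ => ih fun l hl => h _ (congrArg Nat.succ hl)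

lemma expectList_nonneg {F : List A → ℝ} (h : ∀ l, 0 ≤ F l) : 0 ≤ expectList m F := by
  induction m generalizing F with
  | zero => exact h []
  | succ m ih => exact Finset.expect_nonneg fun a _ => ih fun l => h _

lemma expectList_one_sub_div [Nonempty A] (F : List A → ℝ) (t : ℝ) :
    expectList m (fun l => 1 - F l / t) = 1 - expectList m F / t := by
  induction m generalizing F with
  | zero => rfl
  | succ m ih =>
    simp only [expectList, ih, Finset.expect_sub_distrib, Fintype.expect_const, Finset.expect_div]

lemma expectList_add_sum_sq_le [Nonempty A] {g : A → ℝ} (hg : 𝔼 a, g a = 0) {C : ℝ}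
    (hC : ∀ a, g a ^ 2 ≤ C) (m : ℕ) (c : ℝ) :
    expectList m (fun l => (c + (l.map g).sum) ^ 2) ≤ c ^ 2 + m * C := by
  induction m generalizing c with
  | zero => simp [expectList]
  | succ m ih =>
    calc expectList (m + 1) (fun l => (c + (l.map g).sum) ^ 2)
        ≤ 𝔼 a, (c ^ 2 + (m + 1) * C + 2 * c * g a) := Finset.expect_le_expect fun a _ => by
          have := ih (c + g a)
          simp only [List.map_cons, List.sum_cons, ← add_assoc]
          linarith [hC a, add_sq c (g a)]
      _ = c ^ 2 + (m + 1 : ℕ) * C := by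
          rw [Finset.expect_add_distrib, Fintype.expect_const, ← Finset.mul_expect, hg]
          push_cast
          ring

lemma markov_expectList [Nonempty A] {F : List A → ℝ} (hF : ∀ l, 0 ≤ F l) {t : ℝ}
    (ht : 0 < t) {s : Set (List A)} (hs : ∀ l, l.length = m → l ∉ s → t ≤ F l) :
    1 - expectList m F / t ≤ expectList m (s.indicator 1) := by
  rw [← expectList_one_sub_div]
  refine expectList_mono fun l hl => ?_
  by_cases hls : l ∈ s
  · rw [Set.indicator_of_mem hls]
    exact sub_le_self _ (div_nonneg (hF l) ht.le)
  · rw [Set.indicator_of_notMem hls, sub_nonpos, one_le_div ht]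
    exact hs l hl hls

theorem chebyshev_expectList [Nonempty A] {f : A → ℝ} {M : ℝ} (hf₀ : ∀ a, 0 ≤ f a)
    (hfM : ∀ a, f a ≤ M) {ε : ℝ} (hε : 0 < ε) (hm : m ≠ 0) :
    1 - M ^ 2 / (m * ε ^ 2) ≤
      expectList m ({l : List A | |(l.map f).sum / m - 𝔼 a, f a| ≤ ε}.indicator 1) := by
  have hm₀ : (0 : ℝ) < m := Nat.cast_pos.2 (Nat.pos_of_ne_zero hm)
  set μ := 𝔼 a, f a with hμ
  have hμ₀ : 0 ≤ μ := Finset.expect_nonneg fun a _ => hf₀ a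
  have hμM : μ ≤ M := Finset.expect_le Finset.univ_nonempty fun a _ => hfM a
  have hcentered : 𝔼 a, (f a - μ) = 0 := by
    rw [Finset.expect_sub_distrib, Fintype.expect_const, hμ, sub_self]
  have hvar : expectList m (fun l => (l.map fun a => f a - μ).sum ^ 2) ≤ m * M ^ 2 := by
    simpa using expectList_add_sum_sq_le hcentered (C := M ^ 2)
      (fun a => sq_le_sq' (by linarith [hf₀ a]) (by linarith [hfM a])) m 0
  calc 1 - M ^ 2 / (m * ε ^ 2) = 1 - m * M ^ 2 / (m * ε) ^ 2 := by field_simp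
    _ ≤ 1 - expectList m (fun l => (l.map fun a => f a - μ).sum ^ 2) / (m * ε) ^ 2 := by gcongr
    _ ≤ _ := markov_expectList (fun l => sq_nonneg _) (by positivity)
        fun l hl hls => ?_
  rw [sum_map_sub_const, hl, sq_le_sq, abs_of_pos (by positivity : 0 < m * ε),
    show (l.map f).sum - m * μ = m * ((l.map f).sum / m - μ) by field_simp, abs_mul,
    abs_of_pos hm₀]
  exact mul_le_mul_of_nonneg_left (not_le.1 hls).le hm₀.le

end Expectation

section Sample

variable {A B : Type*} [Fintype A] [Fintype B] [DecidableEq A] [DecidableEq B]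

/-- A program that appends to `acc` the numbers of `r` random nodes of the left side and hands the
list to `c`; if the left side is empty, nothing is appended. -/
def sampleMany : ℕ → List ℕ → (List ℕ → Prog) → Prog
  | 0, acc, c => c acc
  | r + 1, acc, c => .sampleLeft fun o => sampleMany r (acc ++ o.toList) c

/-- The state `σ` can arise by sampling the nodes in the list `l`. -/
structure Sampled (w : A → B → ℕ) (l : List A) (σ : State (A ⊕ B)) : Prop where
  records : Records w σ fun _ _ => ∅
  mem_seen : ∀ a ∈ l, Sum.inl a ∈ σ.seen
  length_le : σ.seen.length ≤ l.length

/-- The numbers of the sampled nodes. -/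
def numbers (l : List A) (σ : State (A ⊕ B)) : List ℕ := l.map fun a => index σ.seen (Sum.inl a)

variable {w : A → B → ℕ} {env : Fin 3 → ℚ} {c : List ℕ → Prog} {σ : State (A ⊕ B)} {l : List A}
  {f : List A → ℚ} {K r n : ℕ} {q : ℚ}

lemma sampled_init (w : A → B → ℕ) : Sampled w [] (State.init []) :=
  ⟨records_init List.nodup_nil, by simp, le_rfl⟩

lemma Sampled.concat (h : Sampled w l σ) (a : A) :
    Sampled w (l ++ [a]) (σ.discover (some (Sum.inl a))) where
  records := h.records.discover _
  mem_seen b hb := by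
    rcases List.mem_append.1 hb with hb | hb
    · exact (discover_prefix σ _).subset (h.mem_seen b hb)
    · rw [List.mem_singleton.1 hb]
      exact mem_discover σ _
  length_le := by
    rw [List.length_append, List.length_singleton]
    exact (length_discover_le σ _).trans (Nat.add_le_add_right h.length_le 1)

lemma Sampled.numbers_concat (h : Sampled w l σ) (a : A) :
    numbers (l ++ [a]) (σ.discover (some (Sum.inl a))) =
      numbers l σ ++ [index σ.seen (Sum.inl a)] := by
  simp only [numbers, List.map_append, List.map_singleton, index_discover]
  congr 1
  exact List.map_congr_left fun b hb => index_eq_of_prefix (discover_prefix σ _) (h.mem_seen b hb)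

lemma cost_sampleMany_le
    (hc : ∀ l σ, l.length ≤ K → Sampled w l σ → ∀ o ∈ ((c (numbers l σ)).run w env σ).support,
      o.2 ≤ n)
    (hl : l.length + r ≤ K) (hσ : Sampled w l σ) :
    ∀ o ∈ ((sampleMany r (numbers l σ) c).run w env σ).support, o.2 ≤ n + r := by
  induction r generalizing l σ with
  | zero => exact hc l σ hl hσ
  | succ r ih =>
    intro o ho
    simp only [sampleMany, Prog.run, PMF.mem_support_bind_iff, PMF.mem_support_map_iff,
      draw_support, Finset.mem_map, Finset.mem_univ, true_and] at ho
    obtain ⟨x, (⟨rfl, -⟩ | ⟨-, ⟨a, rfl⟩, rfl⟩), o', ho', rfl⟩ := ho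
    · rw [State.number, Option.toList, List.append_nil] at ho'
      exact Nat.succ_le_succ (ih (by omega) hσ o' ho')
    · have := ih (by simp; omega) (hσ.concat a) o'
      rw [hσ.numbers_concat] at this
      exact Nat.succ_le_succ (this ho')

lemma outputs_sampleMany_of_isEmpty [IsEmpty A] (hc : Outputs w env (c []) σ q n) :
    Outputs w env (sampleMany r [] c) σ q (n + r) := by
  induction r with
  | zero => exact hc
  | succ r ih =>
    intro o ho
    simp only [sampleMany, Prog.run, PMF.mem_support_bind_iff, PMF.mem_support_map_iff,
      draw_support] at ho
    obtain ⟨x, (⟨rfl, -⟩ | ⟨x, hx, rfl⟩), o', ho', rfl⟩ := ho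
    · exact (ih o' ho').imp_right Nat.succ_le_succ
    · simp at hx

lemma expectList_le_prob_sampleMany [Nonempty A]
    (hc : ∀ l σ, l.length ≤ K → Sampled w l σ → Outputs w env (c (numbers l σ)) σ (f l) n)
    (s : Set ℚ) (hl : l.length + r ≤ K) (hσ : Sampled w l σ) :
    ENNReal.ofReal (expectList r fun l' => s.indicator 1 (f (l ++ l'))) ≤
      ((sampleMany r (numbers l σ) c).run w env σ).toOuterMeasure {o | o.1 ∈ s} := by
  induction r generalizing l σ with
  | zero =>
    rw [expectList, List.append_nil]
    by_cases hs : f l ∈ s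
    · rw [Set.indicator_of_mem hs, Pi.one_apply, ENNReal.ofReal_one]
      refine ((PMF.toOuterMeasure_apply_eq_one_iff _ _).2 fun o ho => ?_).ge
      rw [Set.mem_ofPred_eq, (hc l σ hl hσ o ho).1]
      exact hs
    · simp [hs]
  | succ r ih =>
    have hleft : (Finset.univ.map (Function.Embedding.inl : A ↪ A ⊕ B)).Nonempty := by simp
    rw [sampleMany, Prog.run, draw, dif_pos hleft, PMF.bind_map, PMF.toOuterMeasure_bind_apply,
      tsum_fintype, Fintype.sum_sum_type]
    refine le_trans ?_ (le_add_of_nonneg_right zero_le)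
    rw [expectList, Fintype.expect_eq_sum_div_card, Finset.sum_div, ENNReal.ofReal_sum_of_nonneg
      fun a _ => div_nonneg (expectList_nonneg fun l => Set.indicator_nonneg (by simp) _)
        (Nat.cast_nonneg _)]
    refine Finset.sum_le_sum fun a _ => ?_
    rw [PMF.uniformOfFinset_apply_of_mem _ (by simp), Finset.card_map, Finset.card_univ,
      ENNReal.ofReal_div_of_pos (Nat.cast_pos.2 Fintype.card_pos), ENNReal.ofReal_natCast,
      div_eq_mul_inv, mul_comm]
    gcongr
    have hrest := ih (by simp; omega) (hσ.concat a)
    rw [hσ.numbers_concat] at hrest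
    simp only [List.append_assoc, List.singleton_append] at hrest
    rwa [Function.comp_apply, PMF.toOuterMeasure_map_apply]

end Sample

/-! ### The estimator -/

section Bipartite

lemma mem_wNbrs_comm {A B : Type*} [Fintype A] [Fintype B] (w : A → B → ℕ) (s : ℕ)
    (x y : A ⊕ B) :
    x ∈ wNbrs w y s ↔ y ∈ wNbrs w x s := by
  cases x <;> cases y <;> simp [wNbrs]

variable {A B : Type*} [Fintype A] [Fintype B] [DecidableEq A] [DecidableEq B]
  {w : A → B → ℕ} {k : ℕ} {η : ℚ} {T : ℕ}

lemma mem_gainGraph_comm (x y : A ⊕ B) (c : ℚ) :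
    (x, c) ∈ gainGraph w k y ↔ (y, c) ∈ gainGraph w k x := by
  simp only [mem_gainEdges, mem_wNbrs_comm w _ x y]

lemma gain_nonneg {x : A ⊕ B} {e : (A ⊕ B) × ℚ} (he : e ∈ gainGraph w k x) : 0 ≤ e.2 := by
  obtain ⟨s, hs, -, hgain⟩ := mem_gainEdges.1 he
  rw [← hgain, sub_nonneg, Nat.cast_le]
  exact (Finset.mem_Ico.1 hs).2.le

lemma gain_le {x : A ⊕ B} {e : (A ⊕ B) × ℚ} (he : e ∈ gainGraph w k x) : e.2 ≤ k := by
  obtain ⟨s, -, -, hgain⟩ := mem_gainEdges.1 he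
  rw [← hgain]
  exact sub_le_self _ (Nat.cast_nonneg s)

lemma sum_gainGraph_inl (a : A) (F : A ⊕ B → ℚ → ℚ) :
    ∑ e ∈ gainGraph w k (.inl a), F e.1 e.2 =
      ∑ b, if w a b ∈ Finset.Ico 1 k then F (.inr b) (k - w a b) else 0 := by
  have hedges : gainGraph w k (.inl a) =
      ({b | w a b ∈ Finset.Ico 1 k} : Finset B).image fun b => (.inr b, (k : ℚ) - w a b) := by
    ext e
    simp only [mem_gainEdges, wNbrs, Finset.mem_map, Finset.mem_filter, Finset.mem_univ, true_and,
      Finset.mem_image, Function.Embedding.inr_apply]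
    aesop
  rw [hedges, Finset.sum_image fun b _ b' _ h => Sum.inr_injective (Prod.mk.inj h).1,
    Finset.sum_filter]

lemma sum_gainGraph_inr (b : B) (F : A ⊕ B → ℚ → ℚ) :
    ∑ e ∈ gainGraph w k (.inr b), F e.1 e.2 =
      ∑ a, if w a b ∈ Finset.Ico 1 k then F (.inl a) (k - w a b) else 0 := by
  have hedges : gainGraph w k (.inr b) =
      ({a | w a b ∈ Finset.Ico 1 k} : Finset A).image fun a => (.inl a, (k : ℚ) - w a b) := by
    ext e
    simp only [mem_gainEdges, wNbrs, Finset.mem_map, Finset.mem_filter, Finset.mem_univ, true_and,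
      Finset.mem_image, Function.Embedding.inl_apply]
    aesop
  rw [hedges, Finset.sum_image fun a _ a' _ h => Sum.inl_injective (Prod.mk.inj h).1,
    Finset.sum_filter]

/-- The fractional matching of a weighted bipartite graph given by the scaled flow of its truncated
gains. -/
def matching (w : A → B → ℕ) (k : ℕ) (η : ℚ) (T : ℕ) (a : A) (b : B) : ℚ :=
  if w a b ∈ Finset.Ico 1 k then
    scaledFlow (gainGraph w k) η T (.inl a) (.inr b) (k - w a b) else 0

lemma matching_nonneg (a : A) (b : B) : 0 ≤ matching w k η T a b := by
  unfold matching
  split_ifs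
  exacts [scaledFlow_nonneg _ _ _, le_rfl]

lemma sum_matching_left_le_one (a : A) : ∑ b, matching w k η T a b ≤ 1 :=
  (sum_gainGraph_inl a (scaledFlow (gainGraph w k) η T (.inl a))).symm.trans_le
    (sum_scaledFlow_le_one _)

lemma sum_matching_right_le_one (b : B) : ∑ a, matching w k η T a b ≤ 1 :=
  calc ∑ a, matching w k η T a b
      = ∑ e ∈ gainGraph w k (.inr b), scaledFlow (gainGraph w k) η T e.1 (.inr b) e.2 :=
        (sum_gainGraph_inr b fun x c => scaledFlow (gainGraph w k) η T x (.inr b) c).symm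
    _ = ∑ e ∈ gainGraph w k (.inr b), scaledFlow (gainGraph w k) η T (.inr b) e.1 e.2 :=
        Finset.sum_congr rfl fun _ _ => scaledFlow_comm _ _ _
    _ ≤ 1 := sum_scaledFlow_le_one _

lemma localGain_inl (a : A) : localGain (gainGraph w k) η T (.inl a) =
    ∑ b, ((k : ℚ) - w a b) * matching w k η T a b := by
  rw [localGain, sum_gainGraph_inl a fun x c => c * scaledFlow (gainGraph w k) η T (.inl a) x c]
  simp only [matching, mul_ite, mul_zero]

lemma localGain_inr (b : B) : localGain (gainGraph w k) η T (.inr b) =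
    ∑ a, ((k : ℚ) - w a b) * matching w k η T a b := by
  rw [localGain, sum_gainGraph_inr b fun x c => c * scaledFlow (gainGraph w k) η T (.inr b) x c]
  simp only [matching, mul_ite, mul_zero, scaledFlow_comm (Sum.inr b)]

lemma sum_localGain_eq_two_mul : ∑ x, localGain (gainGraph w k) η T x =
    2 * ∑ a, localGain (gainGraph w k) η T (.inl a) := by
  rw [Fintype.sum_sum_type, two_mul]
  simp only [localGain_inl, localGain_inr]
  rw [Finset.sum_comm (s := .univ (α := B))]

end Bipartite

section Estimator

lemma abs_mul_card_sub_sum_le {A : Type*} [Fintype A] {g : A → ℚ} {q ε : ℚ}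
    (h : |(q : ℝ) - Finset.univ.expect fun a => (g a : ℝ)| ≤ ε) :
    |q * Fintype.card A - ∑ a, g a| ≤ ε * Fintype.card A := by
  have hsum := Fintype.card_smul_expect fun a => (g a : ℝ)
  rw [nsmul_eq_mul, mul_comm] at hsum
  have hscaled := mul_le_mul_of_nonneg_right h (Nat.cast_nonneg (α := ℝ) (Fintype.card A))
  rw [← abs_of_nonneg (Nat.cast_nonneg (α := ℝ) (Fintype.card A)), ← abs_mul, Nat.abs_cast,
    sub_mul, hsum] at hscaled
  exact_mod_cast hscaled

/-- Estimate the average of `localGain` over the left side of a bipartite graph by the mean over `m`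
samples, computed in the explored balls around them, and output an expression depending on it. -/
def estimator (k d : ℕ) (η : ℚ) (T m : ℕ) (e : ℚ → Expr) : Prog :=
  sampleMany m [] fun acc => explore k d (T + 2) m (fun _ _ => ∅) fun tbl =>
    .output (e ((acc.map (localGain (fun i => gainEdges k (tbl i)) η T)).sum / m))

variable {A B : Type*} [Fintype A] [Fintype B] [DecidableEq A] [DecidableEq B]
  {w : A → B → ℕ} {env : Fin 3 → ℚ} {k d : ℕ} {η : ℚ} {T m : ℕ} {e : ℚ → Expr}

lemma outputs_explore_mean (hd : ∀ x, ∀ s ∈ Finset.Ico 1 k, wDeg w x s ≤ d) {l : List A}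
    {σ : State (A ⊕ B)} (hl : l.length ≤ m) (hσ : Sampled w l σ) :
    Outputs w env (explore k d (T + 2) m (fun _ _ => ∅) fun tbl => .output (e
        (((numbers l σ).map (localGain (fun i => gainEdges k (tbl i)) η T)).sum / m))) σ
      ((e ((l.map fun a => localGain (gainGraph w k) η T (.inl a)).sum / m)).eval env)
      (0 + exploreCost k d (T + 2) m) := by
  refine outputs_explore hd hσ.records (hσ.length_le.trans hl) fun σ' tbl h => ?_
  have hlocal : (numbers l σ).map (localGain (fun i => gainEdges k (tbl i)) η T) =
      l.map fun a => localGain (gainGraph w k) η T (.inl a) := by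
    rw [numbers, List.map_map]
    refine List.map_congr_left fun a ha => ?_
    rw [Function.comp_apply, ← index_eq_of_prefix h.seen_prefix (hσ.mem_seen a ha)]
    exact (h.faithfulBall _ (hσ.mem_seen a ha)).localGain_eq
  rw [hlocal]
  exact outputs_output _

lemma cost_estimator_le (hd : ∀ x, ∀ s ∈ Finset.Ico 1 k, wDeg w x s ≤ d) :
    ∀ o ∈ ((estimator k d η T m e).run w env (State.init [])).support,
      o.2 ≤ 0 + exploreCost k d (T + 2) m + m :=
  cost_sampleMany_le (K := m) (fun _ _ hl hσ o ho => (outputs_explore_mean hd hl hσ o ho).2)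
    (Nat.zero_add m).le (sampled_init w)

theorem le_prob_estimator (hd : ∀ x, ∀ s ∈ Finset.Ico 1 k, wDeg w x s ≤ d) {ε : ℚ} (hε : 0 < ε)
    (hm : m ≠ 0) {s : Set ℚ}
    (hs : ∀ q, |q * Fintype.card A - ∑ a, localGain (gainGraph w k) η T (.inl a)| ≤
      ε * Fintype.card A → (e q).eval env ∈ s) :
    ENNReal.ofReal (1 - (k : ℝ) ^ 2 / (m * (ε : ℝ) ^ 2)) ≤
      ((estimator k d η T m e).run w env (State.init [])).toOuterMeasure {o | o.1 ∈ s} := by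
  rcases isEmpty_or_nonempty A with hA | hA
  · have hsure : ((estimator k d η T m e).run w env (State.init [])).toOuterMeasure
        {o | o.1 ∈ s} = 1 := by
      refine (PMF.toOuterMeasure_apply_eq_one_iff _ _).2 fun o ho => ?_
      have hout := outputs_sampleMany_of_isEmpty
        (outputs_explore_mean hd (Nat.zero_le m) (sampled_init w)) o ho
      rw [Set.mem_ofPred_eq, hout.1]
      exact hs _ (by simp)
    rw [hsure, ENNReal.ofReal_le_one]
    exact sub_le_self _ (by positivity)
  · set g : A → ℚ := fun a => localGain (gainGraph w k) η T (.inl a)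
    have hg₀ (a : A) : (0 : ℝ) ≤ g a := Rat.cast_nonneg.2 (localGain_nonneg fun _ => gain_nonneg)
    have hgk (a : A) : (g a : ℝ) ≤ k := by
      exact_mod_cast localGain_le (Nat.cast_nonneg k) fun _ => gain_le
    refine le_trans (ENNReal.ofReal_le_ofReal ?_) (expectList_le_prob_sampleMany (K := m)
      (fun l σ => outputs_explore_mean (A := A) hd) s (Nat.zero_add m).le (sampled_init w))
    refine (chebyshev_expectList hg₀ hgk (Rat.cast_pos.2 hε) hm).trans
      (expectList_mono fun l _ => ?_)
    refine Set.indicator_le_indicator_apply_of_subset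
      (t := {l : List A | (e ((l.map g).sum / m)).eval env ∈ s})
      (fun l hl => hs _ (abs_mul_card_sub_sum_le ?_)) zero_le_one
    simpa [List.map_map, Function.comp_def] using hl

end Estimator

/-! ### The balanced graph -/

section Balanced

variable {V : Type*} [Fintype V] [DecidableEq V] {G : SimpleGraph V} [DecidableRel G.Adj] {u v : V}
  {d j : ℕ}

lemma degree_le_wDeg_one (huv : G.Adj u v) :
    G.degree v ≤ wDeg (guvWeight G u v) (.inl ⟨v, by simp [huv]⟩) 1 := by
  rw [wDeg, wNbrs, Finset.card_map, ← SimpleGraph.card_neighborFinset_eq_degree]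
  refine Finset.card_le_card_of_surjOn Subtype.val fun y hy => ?_
  have hvy : G.Adj v y := (G.mem_neighborFinset v y).1 hy
  exact ⟨⟨y, by simp [hvy]⟩, by simp [guvWeight, SimpleGraph.dist_eq_one_iff_adj, hvy], rfl⟩

lemma dist_eq_two_of_mem_sdiff (huv : G.Adj u v) {y : V}
    (hy : y ∈ insert v (G.neighborFinset v) \ insert u (G.neighborFinset u)) : G.dist u y = 2 := by
  obtain ⟨hyv, hyu⟩ := Finset.mem_sdiff.1 hy
  rw [Finset.mem_insert, SimpleGraph.mem_neighborFinset, not_or] at hyu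
  have hvy : G.Adj v y := (eq_or_adj_of_mem_closedNbr hyv).resolve_left fun h => hyu.2 (h ▸ huv)
  have hle : G.dist u y ≤ 2 := G.dist_le (.cons huv (.cons hvy .nil))
  exact hle.antisymm
    ((huv.reachable.trans hvy.reachable).one_lt_dist_of_ne_of_not_adj (Ne.symm hyu.1) hyu.2)

lemma degree_le_degree_add_wDeg_two (huv : G.Adj u v) :
    G.degree v ≤ G.degree u + wDeg (guvWeight G u v) (.inl ⟨u, by simp⟩) 2 := by
  have hsdiff : (insert v (G.neighborFinset v) \ insert u (G.neighborFinset u)).card ≤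
      wDeg (guvWeight G u v) (.inl ⟨u, by simp⟩) 2 := by
    rw [wDeg, wNbrs, Finset.card_map]
    refine Finset.card_le_card_of_surjOn Subtype.val fun y hy => ?_
    exact ⟨⟨y, (Finset.mem_sdiff.1 hy).1⟩, Finset.mem_coe.2 <| Finset.mem_filter.2
      ⟨Finset.mem_univ _, dist_eq_two_of_mem_sdiff huv hy⟩, rfl⟩
  have hcard := Finset.le_card_sdiff (insert u (G.neighborFinset u))
    (insert v (G.neighborFinset v))
  rw [Finset.card_insert_of_notMem (by simp), Finset.card_insert_of_notMem (by simp),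
    SimpleGraph.card_neighborFinset_eq_degree, SimpleGraph.card_neighborFinset_eq_degree] at hcard
  omega

lemma copies_le (huv : G.Adj u v) (hj : j = 1 ∨ j = 2)
    (hd : ∀ x, wDeg (guvWeight G u v) x j ≤ d) :
    (G.degree v + 1) / (G.degree u + 1) ≤ d + 1 := by
  refine Nat.div_le_of_le_mul ?_
  rcases hj with rfl | rfl
  · nlinarith [(degree_le_wDeg_one huv).trans (hd _)]
  · nlinarith [(degree_le_degree_add_wDeg_two huv).trans (Nat.add_le_add_left (hd _) _)]

lemma wDeg_balancedWeight_inr_le (hj : j ≠ 3) (y : ClosedNbr G v) :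
    wDeg (balancedWeight G u v) (.inr y) j ≤
      (G.degree v + 1) / (G.degree u + 1) * wDeg (guvWeight G u v) (.inr y) j := by
  simp only [wDeg, wNbrs, Finset.card_map]
  calc (Finset.univ.filter fun a => balancedWeight G u v a y = j).card
      ≤ (((Finset.univ.filter fun a => guvWeight G u v a y = j) ×ˢ
          (Finset.univ : Finset (Fin ((G.degree v + 1) / (G.degree u + 1))))).map
            Function.Embedding.inl).card := by
        refine Finset.card_le_card ?_
        rintro (⟨a, i⟩ | i) ha
        · have haj : guvWeight G u v a y = j := (Finset.mem_filter.1 ha).2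
          exact Finset.mem_map.2 ⟨(a, i), Finset.mem_product.2
            ⟨Finset.mem_filter.2 ⟨Finset.mem_univ _, haj⟩, Finset.mem_univ _⟩, rfl⟩
        · exact absurd (Finset.mem_filter.1 ha).2.symm hj
    _ = _ := by
        rw [Finset.card_map, Finset.card_product, Finset.card_univ, Fintype.card_fin, mul_comm]

lemma wDeg_balancedWeight_le (huv : G.Adj u v) (hj : j = 1 ∨ j = 2)
    (hd : ∀ x, wDeg (guvWeight G u v) x j ≤ d) (x : BalancedLeft G u v ⊕ ClosedNbr G v) :
    wDeg (balancedWeight G u v) x j ≤ (d + 1) * d := by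
  have hj₃ : j ≠ 3 := by omega
  rcases x with (⟨x, i⟩ | i) | y
  · have hx := hd (.inl x)
    rw [wDeg, wNbrs, Finset.card_map] at hx ⊢
    exact hx.trans (Nat.le_mul_of_pos_left d d.succ_pos)
  · simp [wDeg, wNbrs, balancedWeight, hj₃.symm]
  · exact (wDeg_balancedWeight_inr_le hj₃ y).trans (Nat.mul_le_mul (copies_le huv hj hd) (hd _))

end Balanced

/-! ### Approximating the curvature -/

section Approximation

lemma mul_sub_div_le {k : ℕ} {a b δ : ℝ} (hk : k ≤ 3) (hb : 0 ≤ b) (hδ : 0 ≤ δ)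
    (hratio : (1 - δ / 3) * b ≤ a) : k * (b - a) / (1 + b) ≤ δ := by
  have hk' : (k : ℝ) ≤ 3 := by exact_mod_cast hk
  have hgap : b - a ≤ δ / 3 * b := by linarith
  rw [div_le_iff₀ (by positivity)]
  calc (k : ℝ) * (b - a) ≤ k * (δ / 3 * b) := by gcongr
    _ ≤ 3 * (δ / 3 * b) := by gcongr
    _ ≤ δ * (1 + b) := by linarith

variable {V : Type*} [Fintype V] [DecidableEq V] {G : SimpleGraph V} [DecidableRel G.Adj] {u v : V}
  {d k : ℕ} {η e : ℚ} {T : ℕ}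

lemma exists_dual_gainGraph {A B : Type*} [Fintype A] [Fintype B] [DecidableEq A] [DecidableEq B]
    {w : A → B → ℕ} (hd : ∀ x, ∀ s ∈ Finset.Ico 1 k, wDeg w x s ≤ d) (hη : 0 < η) (hT : T ≠ 0)
    (herr : (k : ℚ) ^ 2 / (2 * η * T) + η * ((k - 1) * d + 1 : ℕ) ^ 2 / 2 ≤ e) :
    ∃ y : A ⊕ B → ℚ, (∀ x, 0 ≤ y x) ∧ (∀ x, ∀ c ∈ gainGraph w k x, c.2 ≤ y x + y c.1) ∧
      ∑ x, y x ≤ ∑ a, localGain (gainGraph w k) η T (.inl a) +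
        (Fintype.card A + Fintype.card B) * e := by
  obtain ⟨y, hy, hfeas, hsum⟩ := exists_dual_le_sum_localGain (N := gainGraph w k)
    mem_gainGraph_comm (Nat.cast_nonneg k) (fun _ _ => gain_le)
    (by exact_mod_cast Nat.le_add_left 1 ((k - 1) * d))
    (fun x => Nat.cast_le.2 ((card_gainEdges_le (hd x)).trans (Nat.le_succ _))) hη hT
  refine ⟨y, hy, hfeas, hsum.trans ?_⟩
  rw [sum_localGain_eq_two_mul, mul_div_cancel_left₀ _ two_ne_zero, Fintype.card_sum, Nat.cast_add]
  gcongr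

lemma hWeight_pos (huv : G.Adj u v) (l : HLeft G u v) (r : HRight G u v) :
    0 < hWeight G u v l r := by
  obtain ⟨hlu, hlv⟩ := Finset.mem_sdiff.1 ((neighborFinset_sdiff_eq huv).subset l.2)
  obtain ⟨hrv, -⟩ := Finset.mem_sdiff.1 ((neighborFinset_sdiff_eq huv.symm).subset r.2)
  exact (reachable_of_mem_closedNbr huv ⟨l, hlu⟩ ⟨r, hrv⟩).pos_dist_of_ne fun h => hlv (h ▸ hrv)

lemma one_sub_curvature_le_localGain (huv : G.Adj u v) (hdeg : G.degree u ≤ G.degree v)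
    (hk : k ≤ 3) :
    1 - curvature G u v ≤ (3 * Fintype.card (HRight G u v) -
      ((∑ l, localGain (gainGraph (hWeight G u v) k) η T (.inl l) : ℚ) : ℝ)) /
        (1 + G.degree v) := by
  set m := matching (hWeight G u v) k η T with hm
  have hmatching (l r) : (0 : ℝ) ≤ m l r := Rat.cast_nonneg.2 (matching_nonneg l r)
  have hrow (l) : ∑ r, m l r ≤ 1 := sum_matching_left_le_one l
  have hcol (r) : ∑ l, m l r ≤ 1 := sum_matching_right_le_one r
  refine (one_sub_curvature_le huv hdeg hmatching (fun l => by exact_mod_cast hrow l)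
    (fun r => by exact_mod_cast hcol r)).trans ?_
  simp only [localGain_inl, ← hm, Rat.cast_sum, Rat.cast_mul, Rat.cast_sub, Rat.cast_natCast]
  gcongr with l _ r _
  · exact hmatching l r
  · exact_mod_cast hk

lemma le_one_sub_curvature_of_dual (huv : G.Adj u v) (hdeg : G.degree u ≤ G.degree v)
    {y : HLeft G u v ⊕ HRight G u v → ℚ} (hy : ∀ x, 0 ≤ y x)
    (hfeas : ∀ x, ∀ c ∈ gainGraph (hWeight G u v) k x, c.2 ≤ y x + y c.1) :
    (k * Fintype.card (HRight G u v) - ((∑ x, y x : ℚ) : ℝ) -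
      k * ((G.degree v : ℝ) - G.degree u)) / (1 + G.degree v) ≤ 1 - curvature G u v := by
  have hpair (l r) : (k : ℚ) - hWeight G u v l r ≤ y (.inl l) + y (.inr r) := by
    rcases lt_or_ge (hWeight G u v l r) k with hlt | hge
    · exact hfeas (.inl l) (.inr r, k - hWeight G u v l r) <| mem_gainEdges.2
        ⟨_, Finset.mem_Ico.2 ⟨hWeight_pos huv l r, hlt⟩, by simp [wNbrs], rfl⟩
    · exact (sub_nonpos.2 (Nat.cast_le.2 hge)).trans (add_nonneg (hy _) (hy _))
  have hle := le_one_sub_curvature huv hdeg (K := k) (yl := fun l => y (.inl l))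
    (yr := fun r => y (.inr r)) (fun r => Rat.cast_nonneg.2 (hy _))
    (fun l r => by exact_mod_cast hpair l r)
  rw [Fintype.sum_sum_type]
  exact_mod_cast hle

lemma card_HLeft_le (huv : G.Adj u v) : Fintype.card (HLeft G u v) ≤ G.degree u :=
  le_of_add_le_left (card_HLeft huv).le

lemma card_HRight_le (huv : G.Adj u v) : Fintype.card (HRight G u v) ≤ G.degree v :=
  le_of_add_le_left (card_HRight huv).le

lemma localGain_le_one_sub_curvature {δ : ℝ} (huv : G.Adj u v) (hdeg : G.degree u ≤ G.degree v)
    (hk : k ≤ 3) (hδ : 0 ≤ δ) (hratio : (1 - δ / 3) * (G.degree v : ℝ) ≤ G.degree u)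
    (hd : ∀ x, ∀ s ∈ Finset.Ico 1 k, wDeg (hWeight G u v) x s ≤ d) (hη : 0 < η) (hT : T ≠ 0)
    (he : 0 ≤ e) (herr : (k : ℚ) ^ 2 / (2 * η * T) + η * ((k - 1) * d + 1 : ℕ) ^ 2 / 2 ≤ e) :
    (k * Fintype.card (HRight G u v) -
      ((∑ l, localGain (gainGraph (hWeight G u v) k) η T (.inl l) : ℚ) : ℝ)) / (1 + G.degree v) -
        2 * e - δ ≤ 1 - curvature G u v := by
  obtain ⟨y, hy, hfeas, hsum⟩ := exists_dual_gainGraph hd hη hT herr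
  set X : ℚ := ∑ l, localGain (gainGraph (hWeight G u v) k) η T (.inl l)
  have hcard : Fintype.card (HLeft G u v) + Fintype.card (HRight G u v) ≤
      2 * (1 + G.degree v) := by
    linarith [card_HLeft_le huv, card_HRight_le huv]
  have hsum' : ((∑ x, y x : ℚ) : ℝ) ≤ X + 2 * (1 + G.degree v) * e := by
    have : ∑ x, y x ≤ X + 2 * (1 + G.degree v) * e :=
      hsum.trans (by gcongr; exact_mod_cast hcard)
    exact_mod_cast this
  calc (k * Fintype.card (HRight G u v) - (X : ℝ)) / (1 + G.degree v) - 2 * e - δ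
      ≤ (k * Fintype.card (HRight G u v) - (X : ℝ)) / (1 + G.degree v) - 2 * e -
          k * ((G.degree v : ℝ) - G.degree u) / (1 + G.degree v) := by
        gcongr
        exact mul_sub_div_le hk (Nat.cast_nonneg _) hδ hratio
    _ = (k * Fintype.card (HRight G u v) - (X + 2 * (1 + G.degree v) * e) -
          k * ((G.degree v : ℝ) - G.degree u)) / (1 + G.degree v) := by
        field_simp
        ring
    _ ≤ (k * Fintype.card (HRight G u v) - ((∑ x, y x : ℚ) : ℝ) -
          k * ((G.degree v : ℝ) - G.degree u)) / (1 + G.degree v) := by gcongr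
    _ ≤ 1 - curvature G u v := le_one_sub_curvature_of_dual huv hdeg hy hfeas

/-- The curvature computed from an estimate `q` of the average gain over the left side of `H`,
lowered by `e` so that errors of the estimate below `e` do not push it above the true value. The
sizes of both sides of `H` are expressed in the known numbers. -/
def outputExpr (e q : ℚ) : Expr :=
  .sub (.const (1 - e)) (.div
    (.sub (.mul (.const 3) (.sub (.var 1) (.add (.var 2) (.const 1))))
      (.mul (.const q) (.sub (.var 0) (.add (.var 2) (.const 1)))))
    (.add (.const 1) (.var 1)))

lemma outputExpr_eval (huv : G.Adj u v) (e q : ℚ) :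
    (outputExpr e q).eval (knownNumbers G u v) =
      1 - e - (3 * Fintype.card (HRight G u v) - q * Fintype.card (HLeft G u v)) /
        (1 + G.degree v) := by
  have hleft := card_HLeft huv
  have hright := card_HRight huv
  have hleft' : (Fintype.card (HLeft G u v) : ℚ) = G.degree u -
      ((G.neighborFinset u ∩ G.neighborFinset v).card + 1) := by
    rw [← hleft]; push_cast; ring
  have hright' : (Fintype.card (HRight G u v) : ℚ) = G.degree v -
      ((G.neighborFinset u ∩ G.neighborFinset v).card + 1) := by
    rw [← hright]; push_cast; ring
  rw [hleft', hright']
  simp [outputExpr, Expr.eval, knownNumbers]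

lemma isAdditiveApprox_outputExpr {δ : ℝ} {q : ℚ} (huv : G.Adj u v)
    (hdeg : G.degree u ≤ G.degree v) (hk : k ≤ 3) (hδ : 0 ≤ δ)
    (hratio : (1 - δ / 3) * (G.degree v : ℝ) ≤ G.degree u)
    (hd : ∀ x, ∀ s ∈ Finset.Ico 1 k, wDeg (hWeight G u v) x s ≤ d) (hη : 0 < η) (hT : T ≠ 0)
    (he : 0 ≤ e) (herr : (k : ℚ) ^ 2 / (2 * η * T) + η * ((k - 1) * d + 1 : ℕ) ^ 2 / 2 ≤ e)
    (hq : |q * Fintype.card (HLeft G u v) -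
      ∑ l, localGain (gainGraph (hWeight G u v) k) η T (.inl l)| ≤
        e * Fintype.card (HLeft G u v)) :
    IsAdditiveApprox G u v (3 - k + 4 * e + δ)
      ((outputExpr e q).eval (knownNumbers G u v) : ℚ) := by
  have hupper := one_sub_curvature_le_localGain (η := η) (T := T) huv hdeg hk
  have hlower := localGain_le_one_sub_curvature huv hdeg hk hδ hratio hd hη hT he herr
  set X : ℚ := ∑ l, localGain (gainGraph (hWeight G u v) k) η T (.inl l)
  set R : ℝ := (Fintype.card (HRight G u v) : ℝ)
  set n : ℝ := 1 + G.degree v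
  have hn : 0 < n := by positivity
  have hL : (Fintype.card (HLeft G u v) : ℝ) ≤ n := by
    refine (Nat.cast_le.2 ((card_HLeft_le huv).trans hdeg)).trans ?_
    exact le_add_of_nonneg_left zero_le_one
  have hR : R ≤ n :=
    (Nat.cast_le.2 (card_HRight_le huv)).trans (le_add_of_nonneg_left zero_le_one)
  set Y : ℝ := (q : ℝ) * Fintype.card (HLeft G u v) with hYdef
  have hYX : |Y - X| ≤ e * n := by
    have hYX_card : |Y - X| ≤ e * Fintype.card (HLeft G u v) := by
      rw [hYdef]
      exact_mod_cast hq
    exact hYX_card.trans (by gcongr)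
  obtain ⟨hYX₁, hYX₂⟩ := abs_le.1 hYX
  have houtput : (((outputExpr e q).eval (knownNumbers G u v) : ℚ) : ℝ) =
      1 - e - (3 * R - Y) / n := by
    rw [outputExpr_eval huv]
    push_cast
    rfl
  have hX : (3 * R - X) / n ≤ (3 * R - Y) / n + e := by
    rw [div_add' _ _ _ hn.ne']
    gcongr
    linarith
  have hY : (3 * R - Y) / n ≤ (k * R - X) / n + (3 - k) + e := by
    have hk' : (0 : ℝ) ≤ 3 - k := sub_nonneg.2 (by exact_mod_cast hk)
    have hkR : (3 - k) * R ≤ (3 - k) * n := by gcongr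
    rw [add_assoc, div_add' _ _ _ hn.ne']
    gcongr
    linarith
  rw [IsAdditiveApprox, houtput]
  constructor <;> linarith

end Approximation

section Parameters

lemma exists_step_parameters {M Δ e : ℚ} (hΔ : 0 < Δ) (he : 0 < e) :
    ∃ (η : ℚ) (T : ℕ), 0 < η ∧ T ≠ 0 ∧ M ^ 2 / (2 * η * T) + η * Δ ^ 2 / 2 ≤ e := by
  have hη : 0 < e / Δ ^ 2 := by positivity
  obtain ⟨T, hT⟩ := exists_nat_gt (M ^ 2 / (e / Δ ^ 2 * e))
  have hT₀ : (0 : ℚ) < T := lt_of_le_of_lt (by positivity) hT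
  refine ⟨e / Δ ^ 2, T, hη, (Nat.cast_pos.1 hT₀).ne', ?_⟩
  have hfirst : M ^ 2 / (2 * (e / Δ ^ 2) * T) ≤ e / 2 := by
    rw [div_lt_iff₀ (by positivity)] at hT
    rw [div_le_iff₀ (by positivity)]
    linarith
  have hsecond : e / Δ ^ 2 * Δ ^ 2 / 2 = e / 2 := by rw [div_mul_cancel₀ _ (by positivity)]
  linarith

lemma exists_sample_size {M e : ℝ} (he : 0 < e) :
    ∃ m : ℕ, m ≠ 0 ∧ 2 / 3 ≤ 1 - M ^ 2 / (m * e ^ 2) := by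
  obtain ⟨m, hm⟩ := exists_nat_gt (3 * M ^ 2 / e ^ 2)
  have hm₀ : (0 : ℝ) < m := lt_of_le_of_lt (by positivity) hm
  refine ⟨m, (Nat.cast_pos.1 hm₀).ne', ?_⟩
  have hthird : M ^ 2 / (m * e ^ 2) ≤ 1 / 3 := by
    rw [div_lt_iff₀ (by positivity)] at hm
    rw [div_le_iff₀ (by positivity)]
    linarith
  linarith

end Parameters

section Approximates

variable {V : Type*} [Fintype V] [DecidableEq V] {G : SimpleGraph V} [DecidableRel G.Adj] {u v : V}

lemma IsAdditiveApprox.mono {r r' c : ℝ} (hr : r ≤ r') (h : IsAdditiveApprox G u v r c) :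
    IsAdditiveApprox G u v r' c :=
  ⟨h.1, h.2.trans (by gcongr)⟩

lemma Prog.Approximates.mono {p : Prog} {T : ℕ} {r r' : ℝ} (hr : r ≤ r')
    (h : p.Approximates G u v T r) : p.Approximates G u v T r' :=
  ⟨h.1, h.2.trans (PMF.toOuterMeasure _ |>.mono fun _ ho => ho.mono hr)⟩

theorem approximates_estimator {k d T m : ℕ} {η e : ℚ} {δ : ℝ} (huv : G.Adj u v)
    (hdeg : G.degree u ≤ G.degree v) (hk : k ≤ 3) (hδ : 0 ≤ δ)
    (hratio : (1 - δ / 3) * (G.degree v : ℝ) ≤ G.degree u)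
    (hd : ∀ x, ∀ s ∈ Finset.Ico 1 k, wDeg (hWeight G u v) x s ≤ d) (hη : 0 < η) (hT : T ≠ 0)
    (he : 0 < e) (herr : (k : ℚ) ^ 2 / (2 * η * T) + η * ((k - 1) * d + 1 : ℕ) ^ 2 / 2 ≤ e)
    (hm : m ≠ 0) (hprob : 2 / 3 ≤ 1 - (k : ℝ) ^ 2 / (m * (e : ℝ) ^ 2)) :
    (estimator k d η T m (outputExpr e)).Approximates G u v (0 + exploreCost k d (T + 2) m + m)
      (3 - k + 4 * e + δ) := by
  refine ⟨cost_estimator_le hd, le_trans ?_ (le_prob_estimator hd he hm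
    (s := {c | IsAdditiveApprox G u v (3 - k + 4 * e + δ) (c : ℝ)})
    fun q => isAdditiveApprox_outputExpr huv hdeg hk hδ hratio hd hη hT he.le herr)⟩
  have hthirds : (2 / 3 : ENNReal) = ENNReal.ofReal (2 / 3) := by
    rw [ENNReal.ofReal_div_of_pos three_pos, ENNReal.ofReal_ofNat, ENNReal.ofReal_ofNat]
  exact hthirds.trans_le (ENNReal.ofReal_le_ofReal hprob)

end Approximates

end RicciQuery

end

open RicciQuery in
theorem mainTheorem5_general (d : ℕ) :
    (∀ j : ℕ, j = 1 ∨ j = 2 → ∃ (D : ℕ) (p : Prog), p.OnlyWeight j ∧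
      ∀ (V : Type w) [Fintype V] [DecidableEq V] (G : SimpleGraph V) [DecidableRel G.Adj]
        (u v : V), G.Adj u v → (∀ x, wDeg (guvWeight G u v) x j ≤ d) →
        ∀ x, wDeg (balancedWeight G u v) x j ≤ D ∧
          ∀ o ∈ (p.run (balancedWeight G u v) (knownNumbers G u v) (State.init [x])).support,
            o.1 = (wDeg (balancedWeight G u v) x j : ℚ) ∧ o.2 ≤ D) ∧
    ∀ k : ℕ, k ≤ 3 → ∀ ε δ : ℝ, 0 < ε → 0 ≤ δ → ∃ (T : ℕ) (p : Prog),
      ∀ (V : Type w) [Fintype V] [DecidableEq V] (G : SimpleGraph V) [DecidableRel G.Adj]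
        (u v : V), G.Adj u v → G.degree u ≤ G.degree v →
        (1 - δ / 3) * (G.degree v : ℝ) ≤ (G.degree u : ℝ) →
        (∀ x, ∀ s ∈ Finset.Ico 1 k, wDeg (hWeight G u v) x s ≤ d) →
        p.Approximates G u v T (3 - k + ε + δ) := by
  refine ⟨fun j hj => ?_, fun k hk ε δ hε hδ => ?_⟩
  · refine ⟨(d + 1) * d, queryAll (List.replicate ((d + 1) * d) (0, j)) (fun _ _ => ∅) fun tbl =>
      .output (.const (tbl 0 j).card), queryAll_onlyWeight (by exact fun _ => trivial) (by simp) _,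
      fun V _ _ G _ u v huv hd x => ?_⟩
    have hx := wDeg_balancedWeight_le huv hj hd x
    exact ⟨hx, outputs_wDeg x hx⟩
  · obtain ⟨e, he, heε⟩ := exists_rat_btwn (show (0 : ℝ) < ε / 4 by positivity)
    have he' : 0 < e := Rat.cast_pos.1 he
    obtain ⟨η, T, hη, hT, herr⟩ := exists_step_parameters (M := k)
      (Δ := ((k - 1) * d + 1 : ℕ)) (by positivity) he'
    obtain ⟨m, hm, hprob⟩ := exists_sample_size (M := k) he
    exact ⟨_, _, fun V _ _ G _ u v huv hdeg hratio hd =>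
      (approximates_estimator huv hdeg hk hδ hratio hd hη hT he' herr hm hprob).mono
        (by linarith)⟩

theorem mainTheorem5 (d : ℕ) (ε δ : ℝ) (hε : 0 < ε) (hδ : 0 < δ) :
    -- bounded weight-`j` degrees in `G_{u,v}` give bounded weight-`j` degrees in `G'_{u,v}`, and
    -- selective degree queries on `G'_{u,v}` are simulated by `O(1)` weighted neighbour queries
    (∀ j : ℕ, j = 1 ∨ j = 2 → ∃ (D : ℕ) (p : RicciQuery.Prog), p.OnlyWeight j ∧
      ∀ (V : Type w) [Fintype V] [DecidableEq V] (G : SimpleGraph V) [DecidableRel G.Adj]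
        (u v : V), G.Adj u v → G.degree u ≤ G.degree v →
        (1 - δ / 3) * (G.degree v : ℝ) ≤ (G.degree u : ℝ) →
        (∀ x, RicciQuery.wDeg (RicciQuery.guvWeight G u v) x j ≤ d) →
        ∀ x, RicciQuery.wDeg (RicciQuery.balancedWeight G u v) x j ≤ D ∧
          ∀ o ∈ (p.run (RicciQuery.balancedWeight G u v) (RicciQuery.knownNumbers G u v)
              (RicciQuery.State.init [x])).support,
            o.1 = (RicciQuery.wDeg (RicciQuery.balancedWeight G u v) x j : ℚ) ∧ o.2 ≤ D) ∧
    -- part (i)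
    (∃ (T : ℕ) (p : RicciQuery.Prog),
      ∀ (V : Type w) [Fintype V] [DecidableEq V] (G : SimpleGraph V) [DecidableRel G.Adj]
        (u v : V), G.Adj u v → G.degree u ≤ G.degree v →
        (1 - δ / 3) * (G.degree v : ℝ) ≤ (G.degree u : ℝ) →
        (∀ x, RicciQuery.wDeg (RicciQuery.hWeight G u v) x 1 ≤ d) →
        p.Approximates G u v T (1 + ε + δ)) ∧
    -- part (ii)
    (∃ (T : ℕ) (p : RicciQuery.Prog),
      ∀ (V : Type w) [Fintype V] [DecidableEq V] (G : SimpleGraph V) [DecidableRel G.Adj]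
        (u v : V), G.Adj u v → G.degree u ≤ G.degree v →
        (1 - δ / 3) * (G.degree v : ℝ) ≤ (G.degree u : ℝ) →
        (∀ x, RicciQuery.wDeg (RicciQuery.hWeight G u v) x 1 ≤ d) →
        (∀ x, RicciQuery.wDeg (RicciQuery.hWeight G u v) x 2 ≤ d) →
        p.Approximates G u v T (1 / 2 + ε + δ)) := by
  obtain ⟨hdegree, happrox⟩ := mainTheorem5_general.{w} d
  obtain ⟨T₁, p₁, hp₁⟩ := happrox 2 (by norm_num) ε δ hε hδ.le
  obtain ⟨T₂, p₂, hp₂⟩ := happrox 3 le_rfl ε δ hε hδ.le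
  refine ⟨fun j hj => ?_, ⟨T₁, p₁, ?_⟩, ⟨T₂, p₂, ?_⟩⟩
  · obtain ⟨D, p, hp, hrun⟩ := hdegree j hj
    exact ⟨D, p, hp, fun V _ _ G _ u v huv _ _ => hrun V G u v huv⟩
  · refine fun V _ _ G _ u v huv hdeg hratio h₁ =>
      (hp₁ V G u v huv hdeg hratio fun x s hs => ?_).mono (by norm_num)
    obtain rfl : s = 1 := by rw [Finset.mem_Ico] at hs; omega
    exact h₁ x
  · refine fun V _ _ G _ u v huv hdeg hratio h₁ h₂ =>
      (hp₂ V G u v huv hdeg hratio fun x s hs => ?_).mono (by norm_num)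
    obtain rfl | rfl : s = 1 ∨ s = 2 := by rw [Finset.mem_Ico] at hs; omega
    exacts [h₁ x, h₂ x]
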